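/- **Definitions.** Let $\mathbf x=(x_k)_{k\in X}$ be a family of indeterminates. A *finite $*$-graph* in $\mathbf x$ is a finite directed graph $T=(V,E)$ (loops and multiple edges allowed) with maps $\gamma:E\to X$ and $\varepsilon:E\to\{1,*\}$; the edge $e$ is labelled by $x_{\gamma(e)}^{\varepsilon(e)}$. A *$*$-test graph* is a finite $*$-graph that is non-empty and connected (as an undirected graph). For a family $\mathbf A=(A_k)_{k\in X}$ of $N\times N$ matrices put $$\frac1N\mathrm{Tr}[T(\mathbf A)]=\frac1N\sum_{\phi:V\to[N]}\ \prod_{e=(v,w)\in E}A_{\gamma(e)}^{\varepsilon(e)}\big(\phi(v),\phi(w)\big).$$ Random matrices $\mathbf A^{(N)}$ whose entries have moments of all orders *converge in distribution of traffics* to a function $\tau$ on $*$-test graphs if $\mathbb E\big[\frac1N\mathrm{Tr}[T(\mathbf A^{(N)})]\big]\to\tau[T]$ as $N\to\infty$ for every $*$-test graph $T$. They *satisfy the decorrelation property* (with limit $\tau$) if for all $n$ and all $*$-test graphs $T_1,\dots,T_n$, $$\mathbb E\Big[\prod_{i=1}^n\frac1N\mathrm{Tr}[T_i(\mathbf A^{(N)})]\Big]\longrightarrow\prod_{i=1}^n\tau[T_i].$$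 The *injective version* $\tau^0$ of $\tau$ is determined by $\tau[T]=\sum_{\pi}\tau^0[T^\pi]$ for all $*$-test graphs $T$, where $\pi$ runs over the partitions of the vertex set of $T$, $T^\pi$ is obtained by identifying the vertices in each block of $\pi$, and the term of the partition into singletons is $\tau^0[T]$. Let $\mathbf x_1,\dots,\mathbf x_p$ be families of pairwise distinct indeterminates, and let $T$ be a $*$-test graph in $(\mathbf x_1,\dots,\mathbf x_p)$. The *components* of $T$ are the maximal connected subgraphs with at least one edge whose edges are all labelled in a same family. Let $\bar T$ be the undirected graph whose vertices are the components of $T$ together with the vertices of $T$ that belong to at least two components, a component being joined to each of these vertices that it contains. $T$ is a *free product* in $\mathbf x_1,\dots,\mathbf x_p$ if $\bar T$ is a tree; the graph with one vertex and no edge is also regarded as a free product (with no component). **Theorem.** Let $\mathbf A_j^{(N)}=(A_{j,k}^{(N)})_{k\in K_j}$, $j=1,\dots,p$, be, for each $N$, independent families of $N\times N$ complex random matrices whose entries have moments of all orders. Assume: 1. for all $j$ except possibly one, for every $N$ and every $N\times N$ permutation matrix $U$, the families $(UA_{j,k}^{(N)}U^*)_{k\in K_j}$ and $(A_{j,k}^{(N)})_{k\in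 K_j}$ have the same law; 2. for every $j$, $\mathbf A_j^{(N)}$ converges in distribution of traffics to some $\tau_j$; 3. for every $j$, $\mathbf A_j^{(N)}$ satisfies the decorrelation property with limit $\tau_j$. Then $\mathbf A_1^{(N)},\dots,\mathbf A_p^{(N)}$ are asymptotically traffic-free: the joint family $(\mathbf A_1^{(N)},\dots,\mathbf A_p^{(N)})$ converges in distribution of traffics to some $\tau$, which equals $\tau_j$ on the $*$-test graphs in $\mathbf x_j$ for each $j$, and for every $*$-test graph $T$ in $(\mathbf x_1,\dots,\mathbf x_p)$, $$\tau^0[T]=\begin{cases}\displaystyle\prod_{\tilde T}\tau^0[\tilde T]&\text{if }T\text{ is a free product in }\mathbf x_1,\dots,\mathbf x_p,\\[1ex]0&\text{otherwise,}\end{cases}$$ where $\tilde T$ runs over the components of $T$. Moreover the joint family satisfies the decorrelation property with limit $\tau$. -/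

import Mathlib

open MeasureTheory ProbabilityTheory Filter Topology

noncomputable section

namespace Traffic

universe u

/-- A finite `*`-graph in the variables `(x_k)_{k ∈ X}`: a finite directed multigraph (loops and
multiple edges allowed) whose edge `e` carries the label `x_{label e}` when `star e = false` and
`x_{label e}^*` when `star e = true`. -/
structure StarGraph (X : Type u) where
  V : Type
  E : Type
  [fintypeV : Fintype V]
  [fintypeE : Fintype E]
  src : E → V
  tgt : E → V
  label : E → X
  star : E → Bool

attribute [instance] StarGraph.fintypeV StarGraph.fintypeE

namespace StarGraph

variable {X : Type u}

/-- Some edge goes from `v` to `w`. -/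
def Linked (T : StarGraph X) (v w : T.V) : Prop := ∃ e, T.src e = v ∧ T.tgt e = w

/-- Connectedness of the underlying undirected graph, whose vertex set must be nonempty. -/
def Connected (T : StarGraph X) : Prop :=
  Nonempty T.V ∧ ∀ v w, Relation.EqvGen T.Linked v w

/-- `T^π`: identify the vertices in a same block of the partition `π`, keeping all edges. -/
def quot (T : StarGraph X) (π : Setoid T.V) : StarGraph X :=
  letI : Fintype (Quotient π) := Fintype.ofFinite _
  { V := Quotient π
    E := T.E
    src := fun e => Quotient.mk π (T.src e)
    tgt := fun e => Quotient.mk π (T.tgt e)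
    label := T.label
    star := T.star }

/-- Relabelling of the variables. -/
def relabel {Y : Type*} (f : X → Y) (T : StarGraph X) : StarGraph Y where
  V := T.V
  E := T.E
  src := T.src
  tgt := T.tgt
  label := fun e => f (T.label e)
  star := T.star

theorem Connected.quot {T : StarGraph X} (h : T.Connected) (π : Setoid T.V) :
    (T.quot π).Connected := by
  obtain ⟨⟨v₀⟩, h⟩ := h
  refine ⟨⟨Quotient.mk π v₀⟩, fun v w => ?_⟩
  obtain ⟨v, rfl⟩ := Quotient.exists_rep v
  obtain ⟨w, rfl⟩ := Quotient.exists_rep w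
  induction h v w with
  | rel x y hxy =>
    obtain ⟨e, rfl, rfl⟩ := hxy
    exact .rel _ _ ⟨e, rfl, rfl⟩
  | refl x => exact .refl _
  | symm x y _ ih => exact .symm _ _ ih
  | trans x y z _ _ ih₁ ih₂ => exact .trans _ _ _ ih₁ ih₂

/-- `Tr[T(A)] = ∑_{φ : V → [N]} ∏_{e = (v, w)} A_{γ(e)}^{ε(e)}(φ(v), φ(w))`. -/
def trace {N : ℕ} (T : StarGraph X) (A : X → Matrix (Fin N) (Fin N) ℂ) : ℂ :=
  letI := Classical.decEq T.V
  ∑ φ : T.V → Fin N, ∏ e : T.E,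
    (if T.star e then (A (T.label e)).conjTranspose else A (T.label e)) (φ (T.src e)) (φ (T.tgt e))

/-- The normalized trace `(1/N) Tr[T(A)]`. -/
def normTrace {N : ℕ} (T : StarGraph X) (A : X → Matrix (Fin N) (Fin N) ℂ) : ℂ :=
  (1 / (N : ℂ)) * T.trace A

end StarGraph

/-- A `*`-test graph: a finite connected `*`-graph. -/
structure TestGraph (X : Type u) extends StarGraph X where
  connected : toStarGraph.Connected

namespace TestGraph

variable {X : Type u}

def quot (T : TestGraph X) (π : Setoid T.V) : TestGraph X :=
  ⟨T.toStarGraph.quot π, T.connected.quot π⟩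

def relabel {Y : Type*} (f : X → Y) (T : TestGraph X) : TestGraph Y :=
  ⟨T.toStarGraph.relabel f, T.connected⟩

end TestGraph

instance finiteSetoid (V : Type*) [Finite V] : Finite (Setoid V) :=
  Finite.of_injective (fun (s : Setoid V) (v w : V) => s.r v w) fun s t h =>
    Setoid.ext fun v w => by
      have := congrFun (congrFun h v) w
      exact iff_of_eq this

instance fintypeSetoid (V : Type*) [Finite V] : Fintype (Setoid V) := Fintype.ofFinite _

theorem card_quot_lt {X : Type u} (T : TestGraph X) {π : Setoid T.V} (h : π ≠ ⊥) :
    Nat.card (T.quot π).V < Nat.card T.V := by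
  have hs : Function.Surjective (Quotient.mk π) := Quotient.exists_rep
  refine lt_of_le_of_ne (Nat.card_le_card_of_surjective _ hs) fun hc => h ?_
  have hb := (Nat.bijective_iff_surjective_and_card (Quotient.mk π)).2 ⟨hs, hc.symm⟩
  refine Setoid.ext fun v w => ⟨fun hvw => hb.1 (Quotient.sound hvw), fun hvw => ?_⟩
  have hvw : v = w := hvw
  exact hvw ▸ π.refl v

open Classical in
/-- The injective version `τ⁰` of `τ`: the solution of `τ[T] = ∑_{π ∈ P(V)} τ⁰[T^π]`, where the term
of the partition `⊥` into singletons is `τ⁰[T]` itself. -/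
def injective {X : Type u} (τ : TestGraph X → ℂ) (T : TestGraph X) : ℂ :=
  τ T - ∑ π : {π : Setoid T.V // π ≠ ⊥}, injective τ (T.quot π.1)
termination_by Nat.card T.V
decreasing_by exact card_quot_lt T π.2

/-! ### Free products of test graphs -/

namespace TestGraph

variable {p : ℕ} {K : Fin p → Type u}

/-- Two edges are adjacent in the same family: their labels belong to the same family of variables
and they have a common endpoint. -/
def SameFamilyAdj (T : TestGraph (Σ j, K j)) (e f : T.E) : Prop :=
  (T.label e).1 = (T.label f).1 ∧
    (T.src e = T.src f ∨ T.src e = T.tgt f ∨ T.tgt e = T.src f ∨ T.tgt e = T.tgt f)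

/-- The connected components of `T` labelled with variables in a same family, encoded by their
sets of edges. -/
def Comp (T : TestGraph (Σ j, K j)) : Type := Quot T.SameFamilyAdj

def compOf (T : TestGraph (Σ j, K j)) (e : T.E) : T.Comp := Quot.mk _ e

instance (T : TestGraph (Σ j, K j)) : Finite T.Comp :=
  Finite.of_surjective T.compOf Quot.exists_rep

instance (T : TestGraph (Σ j, K j)) : Fintype T.Comp := Fintype.ofFinite _

/-- `v` is a vertex of the component `c`. -/
def MemComp (T : TestGraph (Σ j, K j)) (v : T.V) (c : T.Comp) : Prop :=
  ∃ e, T.compOf e = c ∧ (T.src e = v ∨ T.tgt e = v)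

/-- The component `c` as a `*`-graph. -/
def compStarGraph (T : TestGraph (Σ j, K j)) (c : T.Comp) : StarGraph (Σ j, K j) :=
  letI : Fintype {v // T.MemComp v c} := Fintype.ofFinite _
  letI : Fintype {e // T.compOf e = c} := Fintype.ofFinite _
  { V := {v // T.MemComp v c}
    E := {e // T.compOf e = c}
    src := fun e => ⟨T.src e.1, e.1, e.2, Or.inl rfl⟩
    tgt := fun e => ⟨T.tgt e.1, e.1, e.2, Or.inr rfl⟩
    label := fun e => T.label e.1
    star := fun e => T.star e.1 }

theorem compStarGraph_connected (T : TestGraph (Σ j, K j)) (c : T.Comp) :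
    (T.compStarGraph c).Connected := by
  let G := T.compStarGraph c
  have hst : ∀ e : G.E, Relation.EqvGen G.Linked (G.src e) (G.tgt e) :=
    fun e => .rel _ _ ⟨e, rfl, rfl⟩
  have key : ∀ e f : T.E, Relation.EqvGen T.SameFamilyAdj e f →
      ∀ (he : T.compOf e = c) (hf : T.compOf f = c),
        Relation.EqvGen G.Linked (G.src ⟨e, he⟩) (G.src ⟨f, hf⟩) := by
    intro e f h
    induction h with
    | rel e f h =>
      intro he hf
      have s₁ := hst ⟨e, he⟩
      have s₂ := hst ⟨f, hf⟩
      rcases h.2 with h | h | h | h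
      · have : G.src ⟨e, he⟩ = G.src ⟨f, hf⟩ := Subtype.ext h
        rw [this]; exact .refl _
      · have : G.src ⟨e, he⟩ = G.tgt ⟨f, hf⟩ := Subtype.ext h
        rw [this]; exact .symm _ _ s₂
      · have : G.tgt ⟨e, he⟩ = G.src ⟨f, hf⟩ := Subtype.ext h
        rw [← this]; exact s₁
      · have : G.tgt ⟨e, he⟩ = G.tgt ⟨f, hf⟩ := Subtype.ext h
        rw [this] at s₁; exact .trans _ _ _ s₁ (.symm _ _ s₂)
    | refl e => intro _ _; exact .refl _
    | symm e f _ ih => intro he hf; exact .symm _ _ (ih hf he)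
    | trans e f g h₁ _ ih₁ ih₂ =>
      intro he hg
      have hf : T.compOf f = c := (Quot.eqvGen_sound h₁).symm.trans he
      exact .trans _ _ _ (ih₁ he hf) (ih₂ hf hg)
  have hv : ∀ v : G.V, ∃ e : G.E, Relation.EqvGen G.Linked v (G.src e) := by
    rintro ⟨v, e, he, h | h⟩
    · exact ⟨⟨e, he⟩, by
        have : G.src ⟨e, he⟩ = ⟨v, e, he, Or.inl h⟩ := Subtype.ext h
        rw [this]; exact .refl _⟩
    · exact ⟨⟨e, he⟩, by
        have : G.tgt ⟨e, he⟩ = ⟨v, e, he, Or.inr h⟩ := Subtype.ext h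
        rw [← this]; exact .symm _ _ (hst _)⟩
  obtain ⟨e₀, he₀⟩ := Quot.exists_rep c
  refine ⟨⟨G.src ⟨e₀, he₀⟩⟩, fun v w => ?_⟩
  obtain ⟨⟨e, he⟩, h₁⟩ := hv v
  obtain ⟨⟨f, hf⟩, h₂⟩ := hv w
  exact .trans _ _ _ h₁ (.trans _ _ _ (key e f (Quot.eqvGen_exact (he.trans hf.symm)) he hf)
    (.symm _ _ h₂))

/-- The component `c` as a `*`-test graph. -/
def comp (T : TestGraph (Σ j, K j)) (c : T.Comp) : TestGraph (Σ j, K j) :=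
  ⟨T.compStarGraph c, T.compStarGraph_connected c⟩

/-- The vertices of `T` that are common to several components. -/
def CommonVertex (T : TestGraph (Σ j, K j)) : Type :=
  {v : T.V // ∃ c c', c ≠ c' ∧ T.MemComp v c ∧ T.MemComp v c'}

/-- The undirected graph of components: its vertices are the components of `T` and the vertices of
`T` common to several components; a component is joined to the common vertices it contains. -/
def componentGraph (T : TestGraph (Σ j, K j)) : SimpleGraph (T.Comp ⊕ T.CommonVertex) :=
  SimpleGraph.fromRel fun a b =>
    ∃ (c : T.Comp) (v : T.CommonVertex), a = Sum.inl c ∧ b = Sum.inr v ∧ T.MemComp v.1 c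

/-- `T` is a free product when its graph of components is a tree. The test graph with one vertex and
no edge, for which the graph of components is empty, counts as a (trivial) free product. -/
def IsFreeProduct (T : TestGraph (Σ j, K j)) : Prop :=
  IsEmpty T.E ∨ T.componentGraph.IsTree

end TestGraph

open Classical in
/-- `τ` makes the families of variables traffic-free. -/
def IsTrafficFree {p : ℕ} {K : Fin p → Type u} (τ : TestGraph (Σ j, K j) → ℂ) : Prop :=
  ∀ T, injective τ T = if T.IsFreeProduct then ∏ c : T.Comp, injective τ (T.comp c) else 0

/-! ### Random matrices -/

variable {Ω : ℕ → Type*} [∀ N, MeasurableSpace (Ω N)] {X : Type u}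

/-- `A N k`, `k ∈ X`, are random `N × N` matrices for every `N`: their entries are measurable and
admit moments of any order. -/
def HasAllMoments (μ : ∀ N, Measure (Ω N)) (A : ∀ N, X → Ω N → Matrix (Fin N) (Fin N) ℂ) : Prop :=
  ∀ N k a b, Measurable (fun ω => A N k ω a b) ∧ ∀ q : ℕ, MemLp (fun ω => A N k ω a b) q (μ N)

/-- For every `N` and permutation matrix `U`, the family `(U A_k U^*)_k` has the law of
`(A_k)_k`. -/
def PermInvariant (μ : ∀ N, Measure (Ω N)) (A : ∀ N, X → Ω N → Matrix (Fin N) (Fin N) ℂ) : Prop :=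
  ∀ N (σ : Equiv.Perm (Fin N)),
    (μ N).map (fun ω k a b =>
        (σ.permMatrix ℂ * A N k ω * (σ.permMatrix ℂ).conjTranspose) a b : Ω N → X → Fin N → Fin N → ℂ)
      = (μ N).map (fun ω k a b => A N k ω a b : Ω N → X → Fin N → Fin N → ℂ)

/-- Convergence in distribution of traffics to `τ`: for any test graph `T`,
`E[(1/N) Tr[T(A)]] → τ[T]`. -/
def ConvergesInTraffics (μ : ∀ N, Measure (Ω N)) (A : ∀ N, X → Ω N → Matrix (Fin N) (Fin N) ℂ)
    (τ : TestGraph X → ℂ) : Prop :=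
  ∀ T : TestGraph X,
    Tendsto (fun N => ∫ ω, T.normTrace (fun k => A N k ω) ∂(μ N)) atTop (𝓝 (τ T))

/-- Decorrelation: `E[∏_i (1/N) Tr[T_i(A)]] → ∏_i τ[T_i]` for any test graphs `T_1, …, T_n`. -/
def Decorrelated (μ : ∀ N, Measure (Ω N)) (A : ∀ N, X → Ω N → Matrix (Fin N) (Fin N) ℂ)
    (τ : TestGraph X → ℂ) : Prop :=
  ∀ (n : ℕ) (T : Fin n → TestGraph X),
    Tendsto (fun N => ∫ ω, ∏ i, (T i).normTrace (fun k => A N k ω) ∂(μ N)) atTop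
      (𝓝 (∏ i, τ (T i)))

end Traffic

end

/-! Sorting the maps `φ` by their kernel gives Tr[T] = ∑_π Tr⁰[T^π], where Tr⁰ (`injTrace`) sums
over injective maps only. This is the relation that defines τ⁰ from τ, so decorrelation can be
stated with injective traces instead of traces. Moreover, a product of injective traces is the
injective trace of the disjoint union plus those of proper quotients. The latter have fewer
connected components, hence are negligible after normalization. Decorrelation thus becomes
`SigmaFactorizes`: for a disjoint union of n test graphs S_i, N^{-n} E Tr⁰ tends to ∏ τ⁰[S_i].

This form suits independent families. Let T have m vertices, and let T_j keep all its vertices but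
only the edges of family j. By independence the expected weight of a map is a product over j. By
invariance all factors but one at most do not depend on the injective map. Therefore E Tr⁰[T] =
(N)_m ∏_j E Tr⁰[T_j] / (N)_m, where (N)_m = N(N-1)⋯(N-m+1) counts the injective maps
(`integral_injTrace_eq`). If T_j has C_j connected components, each E Tr⁰[T_j] is N^{C_j} times a
convergent sequence, so only an exponent of N is left to study.

For T connected, 1 + p·m - (m + ∑ C_j) is the number of independent cycles of the graph of
components: it is nonnegative, and zero exactly for free products (`card_add_sum_card_connComp_le`,
`isFreeProduct_iff`). Summing over the terms of a disjoint union gives the joint limit and joint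
decorrelation together (`sigmaFactorizes_joint`). -/

noncomputable section

namespace Traffic

universe u v

open Classical Finset

/-! ### Injective traces -/

namespace StarGraph

variable {X : Type u} {Y : Type v} {N : ℕ}

/-- The matrix `A_{γ(e)}^{ε(e)}` carried by the edge `e`. -/
def entry (T : StarGraph X) (A : X → Matrix (Fin N) (Fin N) ℂ) (e : T.E) :
    Matrix (Fin N) (Fin N) ℂ :=
  if T.star e then (A (T.label e)).conjTranspose else A (T.label e)

/-- The contribution of the map `φ` to the trace. -/
def weight (T : StarGraph X) (A : X → Matrix (Fin N) (Fin N) ℂ) (φ : T.V → Fin N) : ℂ :=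
  ∏ e : T.E, T.entry A e (φ (T.src e)) (φ (T.tgt e))

/-- The trace restricted to the injective maps `φ`. -/
def injTrace (T : StarGraph X) (A : X → Matrix (Fin N) (Fin N) ℂ) : ℂ :=
  ∑ φ : T.V → Fin N with Function.Injective φ, T.weight A φ

theorem trace_eq_sum_weight (T : StarGraph X) (A : X → Matrix (Fin N) (Fin N) ℂ) :
    T.trace A = ∑ φ : T.V → Fin N, T.weight A φ := by
  unfold trace weight entry
  congr!

theorem weight_congr {T : StarGraph X} {T' : StarGraph Y} {A : X → Matrix (Fin N) (Fin N) ℂ}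
    {A' : Y → Matrix (Fin N) (Fin N) ℂ} (v : T.V → T'.V) (e : T.E ≃ T'.E)
    (hs : ∀ x, T'.src (e x) = v (T.src x)) (ht : ∀ x, T'.tgt (e x) = v (T.tgt x))
    (he : ∀ x, T'.entry A' (e x) = T.entry A x) (φ : T'.V → Fin N) :
    T.weight A (φ ∘ v) = T'.weight A' φ := by
  unfold weight
  refine Fintype.prod_equiv e _ _ fun x => ?_
  rw [hs, ht, he, Function.comp_apply, Function.comp_apply]

/-- Isomorphic graphs have the same injective trace. -/
theorem injTrace_congr {T : StarGraph X} {T' : StarGraph Y} {A : X → Matrix (Fin N) (Fin N) ℂ}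
    {A' : Y → Matrix (Fin N) (Fin N) ℂ} (v : T.V ≃ T'.V) (e : T.E ≃ T'.E)
    (hs : ∀ x, T'.src (e x) = v (T.src x)) (ht : ∀ x, T'.tgt (e x) = v (T.tgt x))
    (he : ∀ x, T'.entry A' (e x) = T.entry A x) :
    T.injTrace A = T'.injTrace A' := by
  unfold injTrace
  symm
  refine Finset.sum_equiv (v.arrowCongr (Equiv.refl _)).symm (fun φ => ?_) fun φ _ => ?_
  · simp only [mem_filter, mem_univ, true_and]
    exact (Function.Injective.of_comp_iff' (f := φ) (v.bijective)).symm
  · exact (weight_congr v e hs ht he φ).symm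

/-- A map with kernel `π` factors uniquely through the quotient, as an injective map. -/
theorem sum_weight_of_ker_eq (T : StarGraph X) (A : X → Matrix (Fin N) (Fin N) ℂ)
    (π : Setoid T.V) :
    ∑ φ : T.V → Fin N with Setoid.ker φ = π, T.weight A φ = (T.quot π).injTrace A := by
  unfold injTrace
  symm
  refine Finset.sum_bij (fun (ψ : Quotient π → Fin N) _ => fun v => ψ (Quotient.mk π v))
    (fun ψ hψ => ?_) (fun ψ _ ψ' _ h => ?_) (fun φ hφ => ?_) (fun ψ _ => ?_)
  · have hψ : Function.Injective ψ := (mem_filter.1 hψ).2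
    refine mem_filter.2 ⟨mem_univ _, Setoid.ext fun v w => ?_⟩
    rw [Setoid.ker_def]
    exact ⟨fun h => Quotient.exact (hψ h), fun h => congrArg ψ (Quotient.sound h)⟩
  · funext q
    obtain ⟨v, rfl⟩ := Quotient.exists_rep q
    exact congrFun h v
  · simp only [mem_filter, mem_univ, true_and] at hφ
    subst hφ
    exact ⟨Quotient.lift φ fun _ _ h => h,
      mem_filter.2 ⟨mem_univ _, Setoid.kerLift_injective φ⟩, rfl⟩
  · rfl

theorem sum_weight_filter (T : StarGraph X) (A : X → Matrix (Fin N) (Fin N) ℂ)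
    (P : Setoid T.V → Prop) :
    ∑ φ : T.V → Fin N with P (Setoid.ker φ), T.weight A φ
      = ∑ π : Setoid T.V with P π, (T.quot π).injTrace A := by
  simp_rw [← sum_weight_of_ker_eq]
  rw [Finset.sum_filter, Finset.sum_filter,
    ← Finset.sum_fiberwise _ (fun φ : T.V → Fin N => Setoid.ker φ)]
  refine Finset.sum_congr rfl fun π _ => ?_
  split_ifs with h
  · exact Finset.sum_congr rfl fun φ hφ => by rw [(mem_filter.1 hφ).2, if_pos h]
  · exact Finset.sum_eq_zero fun φ hφ => by rw [(mem_filter.1 hφ).2, if_neg h]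

theorem injTrace_quot_bot (T : StarGraph X) (A : X → Matrix (Fin N) (Fin N) ℂ) :
    (T.quot ⊥).injTrace A = T.injTrace A := by
  rw [← sum_weight_of_ker_eq]
  unfold injTrace
  simp_rw [Setoid.injective_iff_ker_bot]

/-- This has the shape of the recursion defining `injective`, at fixed N and before any expectation.
-/
theorem trace_eq_sum_injTrace (T : StarGraph X) (A : X → Matrix (Fin N) (Fin N) ℂ) :
    T.trace A = T.injTrace A + ∑ π : {π : Setoid T.V // π ≠ ⊥}, (T.quot π.1).injTrace A := by
  have h := T.sum_weight_filter A fun _ => True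
  rw [Finset.filter_true, Finset.filter_true] at h
  rw [trace_eq_sum_weight, h, ← Finset.add_sum_erase _ _ (mem_univ (⊥ : Setoid T.V)),
    injTrace_quot_bot]
  congr 1
  refine Finset.sum_subtype _ (fun π => ?_) _
  simp

/-! ### Disjoint unions and connected components -/

/-- The disjoint union of a finite family of graphs. -/
def sigma {I : Type} [Fintype I] (S : I → StarGraph X) : StarGraph X where
  V := Σ i, (S i).V
  E := Σ i, (S i).E
  src := fun e => ⟨e.1, (S e.1).src e.2⟩
  tgt := fun e => ⟨e.1, (S e.1).tgt e.2⟩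
  label := fun e => (S e.1).label e.2
  star := fun e => (S e.1).star e.2

/-- The partition `π` of the vertices of a disjoint union separates the vertices of each term. -/
def Separates {I : Type} [Fintype I] (S : I → StarGraph X) (π : Setoid (sigma S).V) : Prop :=
  ∀ i (v w : (S i).V), π ⟨i, v⟩ ⟨i, w⟩ → v = w

theorem weight_sigma {I : Type} [Fintype I] (S : I → StarGraph X)
    (A : X → Matrix (Fin N) (Fin N) ℂ) (φ : (Σ i, (S i).V) → Fin N) :
    (sigma S).weight A φ = ∏ i, (S i).weight A fun v => φ ⟨i, v⟩ := by
  unfold weight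
  exact Fintype.prod_sigma _

/-- A tuple of injective maps is one map on the disjoint union, free to take equal values on
different terms. Its kernel is thus an arbitrary partition that separates each term; the partition
`⊥` gives the leading term. -/
theorem prod_injTrace {I : Type} [Fintype I] (S : I → StarGraph X)
    (A : X → Matrix (Fin N) (Fin N) ℂ) :
    ∏ i, (S i).injTrace A = (sigma S).injTrace A +
      ∑ π : {π : Setoid (sigma S).V // π ≠ ⊥ ∧ Separates S π}, ((sigma S).quot π.1).injTrace A := by
  have h₁ : ∏ i, (S i).injTrace A =
      ∑ φ : (sigma S).V → Fin N with Separates S (Setoid.ker φ), (sigma S).weight A φ := by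
    unfold injTrace
    rw [Finset.prod_univ_sum]
    symm
    refine Finset.sum_equiv (Equiv.piCurry fun _ _ => Fin N) (fun φ => ?_) fun φ _ => ?_
    · rw [Fintype.mem_piFinset]
      refine ⟨fun h i => ?_, fun h => ?_⟩
      · exact mem_filter.2 ⟨mem_univ _, (mem_filter.1 h).2 i⟩
      · exact mem_filter.2 ⟨mem_univ _, fun i => (mem_filter.1 (h i)).2⟩
    · exact weight_sigma S A φ
  rw [h₁, sum_weight_filter (sigma S) A (Separates S), ← Finset.add_sum_erase _ _ (a := (⊥ : Setoid (sigma S).V)),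
    injTrace_quot_bot]
  · congr 1
    refine Finset.sum_subtype _ (fun π => ?_) _
    simp
  · simp only [mem_filter, mem_univ, true_and]
    intro i v w h
    exact eq_of_heq (Sigma.mk.inj h).2

/-- The connected component of index `c` as a graph. -/
def connCompStarGraph (T : StarGraph X) (c : Quot T.Linked) : StarGraph X where
  V := {v // Quot.mk T.Linked v = c}
  E := {e // Quot.mk T.Linked (T.src e) = c}
  fintypeV := Fintype.ofFinite _
  fintypeE := Fintype.ofFinite _
  src := fun e => ⟨T.src e.1, e.2⟩
  tgt := fun e => ⟨T.tgt e.1, (Quot.sound ⟨e.1, rfl, rfl⟩ : Quot.mk T.Linked _ = _) ▸ e.2⟩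
  label := fun e => T.label e.1
  star := fun e => T.star e.1

theorem connCompStarGraph_connected (T : StarGraph X) (c : Quot T.Linked) :
    (T.connCompStarGraph c).Connected := by
  have key : ∀ v w : T.V, Relation.EqvGen T.Linked v w →
      ∀ (hv : Quot.mk T.Linked v = c) (hw : Quot.mk T.Linked w = c),
        Relation.EqvGen (T.connCompStarGraph c).Linked ⟨v, hv⟩ ⟨w, hw⟩ := by
    intro v w h
    induction h with
    | rel v w h =>
      obtain ⟨e, rfl, rfl⟩ := h
      intro hv hw
      exact .rel _ _ ⟨⟨e, hv⟩, rfl, rfl⟩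
    | refl v => intro _ _; exact .refl _
    | symm v w _ ih => intro hv hw; exact .symm _ _ (ih hw hv)
    | trans x y z h₁ _ ih₁ ih₂ =>
      intro hx hz
      have hy : Quot.mk T.Linked y = c := (Quot.eqvGen_sound h₁).symm.trans hx
      exact .trans _ _ _ (ih₁ hx hy) (ih₂ hy hz)
  obtain ⟨v, hv⟩ := Quot.exists_rep c
  exact ⟨⟨⟨v, hv⟩⟩, fun x y => key x.1 y.1 (Quot.eqvGen_exact (x.2.trans y.2.symm)) x.2 y.2⟩

/-- The connected component of index `c` as a test graph. -/
def connComp (T : StarGraph X) (c : Quot T.Linked) : TestGraph X :=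
  ⟨T.connCompStarGraph c, T.connCompStarGraph_connected c⟩

instance (T : StarGraph X) : Finite (Quot T.Linked) :=
  Finite.of_surjective (Quot.mk T.Linked) Quot.exists_rep

instance (T : StarGraph X) : Fintype (Quot T.Linked) := Fintype.ofFinite _

theorem injTrace_sigma_connComp (T : StarGraph X) (A : X → Matrix (Fin N) (Fin N) ℂ) :
    (sigma fun c => (T.connComp c).toStarGraph).injTrace A = T.injTrace A :=
  injTrace_congr (Equiv.sigmaFiberEquiv (Quot.mk T.Linked))
    (Equiv.sigmaFiberEquiv fun e => Quot.mk T.Linked (T.src e))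
    (fun _ => rfl) (fun _ => rfl) (fun _ => rfl)

/-- Identifying vertices of distinct terms of a disjoint union of connected graphs lowers the number
of connected components. -/
theorem card_connComp_quot_sigma_lt {I : Type} [Fintype I] (S : I → TestGraph X)
    {π : Setoid (sigma fun i => (S i).toStarGraph).V} (hπ : π ≠ ⊥) (hs : Separates (fun i => (S i).toStarGraph) π) :
    Fintype.card (Quot ((sigma fun i => (S i).toStarGraph).quot π).Linked) < Fintype.card I := by
  let G := sigma fun i => (S i).toStarGraph
  have v₀ : ∀ i, (S i).V := fun i => (S i).connected.1.some
  let f : I → Quot (G.quot π).Linked := fun i => Quot.mk _ (Quotient.mk π ⟨i, v₀ i⟩)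
  have hf : ∀ i (v : (S i).V), Quot.mk (G.quot π).Linked (Quotient.mk π ⟨i, v⟩) = f i := by
    intro i v
    refine Quot.eqvGen_sound ?_
    generalize v₀ i = w
    induction (S i).connected.2 v w with
    | rel x y h =>
      obtain ⟨e, rfl, rfl⟩ := h
      exact .rel _ _ ⟨⟨i, e⟩, rfl, rfl⟩
    | refl x => exact .refl _
    | symm x y _ ih => exact .symm _ _ ih
    | trans x y z _ _ ih₁ ih₂ => exact .trans _ _ _ ih₁ ih₂
  have hsurj : Function.Surjective f := by
    intro c
    obtain ⟨q, rfl⟩ := Quot.exists_rep c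
    obtain ⟨⟨i, v⟩, rfl⟩ := Quotient.exists_rep q
    exact ⟨i, (hf i v).symm⟩
  -- If `f` were injective, equivalent vertices would lie in the same term and hence coincide, since
  -- `π` separates each term.
  refine Fintype.card_lt_of_surjective_not_injective f hsurj fun hinj => hπ ?_
  refine Setoid.ext fun x y => ⟨fun h => ?_, fun h => ?_⟩
  · obtain ⟨i, v⟩ := x
    obtain ⟨j, w⟩ := y
    have hij : i = j := hinj (by
      rw [← hf i v, ← hf j w]
      exact congrArg _ (Quotient.sound h))
    subst hij
    rw [hs i v w h]
    exact (⊥ : Setoid G.V).refl _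
  · have h : x = y := h
    exact h ▸ π.refl x

end StarGraph

/-! ### Injective versions -/

variable {X : Type u}

theorem eq_injective_add_sum (τ : TestGraph X → ℂ) (T : TestGraph X) :
    τ T = injective τ T + ∑ π : {π : Setoid T.V // π ≠ ⊥}, injective τ (T.quot π.1) := by
  conv_rhs => rw [injective]
  ring

/-- The recursion has only one solution, because proper quotients have fewer vertices. -/
theorem injective_eq_of_forall {τ t : TestGraph X → ℂ}
    (h : ∀ T, τ T = t T + ∑ π : {π : Setoid T.V // π ≠ ⊥}, t (T.quot π.1)) (T : TestGraph X) :
    injective τ T = t T := by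
  induction hn : Nat.card T.V using Nat.strong_induction_on generalizing T with
  | _ n ih =>
    have hs : ∀ π : {π : Setoid T.V // π ≠ ⊥}, injective τ (T.quot π.1) = t (T.quot π.1) :=
      fun π => ih _ (hn ▸ card_quot_lt T π.2) (T.quot π.1) rfl
    rw [injective, h T]
    simp only [hs]
    ring

theorem injective_trace {N : ℕ} (A : X → Matrix (Fin N) (Fin N) ℂ) (T : TestGraph X) :
    injective (fun T => T.trace A) T = T.injTrace A :=
  injective_eq_of_forall (t := fun T => T.injTrace A) (fun T => T.trace_eq_sum_injTrace A) T

/-- The injective version is a finite linear combination. -/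
theorem exists_injective_eq_sum (T : TestGraph X) :
    ∃ (ι : Type) (_ : Fintype ι) (a : ι → ℂ) (S : ι → TestGraph X),
      ∀ τ : TestGraph X → ℂ, injective τ T = ∑ k, a k * τ (S k) := by
  induction hn : Nat.card T.V using Nat.strong_induction_on generalizing T with
  | _ n ih =>
    choose ι hι a S h using fun π : {π : Setoid T.V // π ≠ ⊥} =>
      ih _ (hn ▸ card_quot_lt T π.2) (T.quot π.1) rfl
    refine ⟨Option (Σ π, ι π), inferInstance, fun k => k.elim 1 fun x => -a x.1 x.2,
      fun k => k.elim T fun x => S x.1 x.2, fun τ => ?_⟩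
    rw [injective, Fintype.sum_option, Fintype.sum_sigma]
    simp [h, sub_eq_add_neg]

section

/-! ### Moments -/

section Moments

variable {Ω : Type*} [MeasurableSpace Ω] {μ : Measure Ω}

theorem memLp_mul_of_forall {f g : Ω → ℂ} (hf : ∀ q : ℕ, MemLp f q μ) (hg : ∀ q : ℕ, MemLp g q μ)
    (q : ℕ) : MemLp (fun ω => f ω * g ω) q μ := by
  -- The moment of order q of a product is controlled by moments of order 2q of the factors.
  have h : ENNReal.HolderTriple ((2 * q : ℕ) : ENNReal) ((2 * q : ℕ) : ENNReal) (q : ENNReal) := by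
    constructor
    push_cast
    rw [ENNReal.mul_inv (.inl (by simp)) (.inl (by simp)), ← add_mul, ENNReal.inv_two_add_inv_two,
      one_mul]
  exact (hg (2 * q)).mul (hf (2 * q)) (hpqr := h)

theorem memLp_prod_of_forall [IsFiniteMeasure μ] {ι : Type*} (s : Finset ι) {f : ι → Ω → ℂ}
    (hf : ∀ i ∈ s, ∀ q : ℕ, MemLp (f i) q μ) (q : ℕ) : MemLp (fun ω => ∏ i ∈ s, f i ω) q μ := by
  induction s using Finset.induction_on generalizing q with
  | empty => simpa using memLp_const _
  | insert a s ha ih =>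
    simp_rw [Finset.prod_insert ha]
    exact memLp_mul_of_forall (hf a (mem_insert_self a s))
      (ih fun i hi => hf i (mem_insert_of_mem hi)) q

end Moments

variable {Ω : ℕ → Type*} [∀ N, MeasurableSpace (Ω N)] {X : Type u}
  {μ : ∀ N, Measure (Ω N)} {A : ∀ N, X → Ω N → Matrix (Fin N) (Fin N) ℂ}

theorem HasAllMoments.memLp_weight [∀ N, IsFiniteMeasure (μ N)] (hA : HasAllMoments μ A)
    (T : StarGraph X) (N : ℕ) (φ : T.V → Fin N) (q : ℕ) :
    MemLp (fun ω => T.weight (fun k => A N k ω) φ) q (μ N) := by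
  refine memLp_prod_of_forall _ (fun e _ q => ?_) q
  unfold StarGraph.entry
  split_ifs
  · exact ((hA N _ _ _).2 q).star
  · exact (hA N _ _ _).2 q

theorem HasAllMoments.memLp_injTrace [∀ N, IsFiniteMeasure (μ N)] (hA : HasAllMoments μ A)
    (T : StarGraph X) (N q : ℕ) : MemLp (fun ω => T.injTrace fun k => A N k ω) q (μ N) :=
  memLp_finsetSum _ fun φ _ => hA.memLp_weight T N φ q

theorem HasAllMoments.integrable_injTrace [∀ N, IsFiniteMeasure (μ N)] (hA : HasAllMoments μ A)
    (T : StarGraph X) (N : ℕ) : Integrable (fun ω => T.injTrace fun k => A N k ω) (μ N) :=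
  memLp_one_iff_integrable.1 (by simpa using hA.memLp_injTrace T N 1)

theorem HasAllMoments.memLp_normTrace [∀ N, IsFiniteMeasure (μ N)] (hA : HasAllMoments μ A)
    (T : StarGraph X) (N q : ℕ) : MemLp (fun ω => T.normTrace fun k => A N k ω) q (μ N) := by
  unfold StarGraph.normTrace
  simp_rw [StarGraph.trace_eq_sum_weight]
  exact (memLp_finsetSum _ fun φ _ => hA.memLp_weight T N φ q).const_mul _

/-! ### Decorrelation of injective traces -/

/-- Asymptotic factorization of the expectations of products of functionals of test graphs. -/
def Factorizes (μ : ∀ N, Measure (Ω N)) (F : ∀ N, TestGraph X → Ω N → ℂ) (t : TestGraph X → ℂ) :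
    Prop :=
  ∀ (I : Type) [Fintype I] (S : I → TestGraph X),
    Tendsto (fun N => ∫ ω, ∏ i, F N (S i) ω ∂(μ N)) atTop (𝓝 (∏ i, t (S i)))

/-- Asymptotic factorization of the expectations of the injective traces of disjoint unions. -/
def SigmaFactorizes (μ : ∀ N, Measure (Ω N)) (A : ∀ N, X → Ω N → Matrix (Fin N) (Fin N) ℂ)
    (t : TestGraph X → ℂ) : Prop :=
  ∀ (I : Type) [Fintype I] (S : I → TestGraph X),
    Tendsto (fun N : ℕ => (1 / (N : ℂ)) ^ Fintype.card I *
      ∫ ω, (StarGraph.sigma fun i => (S i).toStarGraph).injTrace (fun k => A N k ω) ∂(μ N)) atTop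
      (𝓝 (∏ i, t (S i)))

theorem Decorrelated.factorizes {τ : TestGraph X → ℂ} (h : Decorrelated μ A τ) :
    Factorizes μ (fun N T ω => T.normTrace fun k => A N k ω) τ := by
  intro I _ S
  let e := Fintype.equivFin I
  have := h _ fun i => S (e.symm i)
  rw [Equiv.prod_comp e.symm fun i => τ (S i)] at this
  refine this.congr fun N => integral_congr_ae (.of_forall fun ω => ?_)
  exact Equiv.prod_comp e.symm fun i => (S i).normTrace fun k => A N k ω

/-- Asymptotic factorization passes to linear combinations. -/
theorem Factorizes.linear [∀ N, IsFiniteMeasure (μ N)] {F G : ∀ N, TestGraph X → Ω N → ℂ}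
    {t s : TestGraph X → ℂ}
    (h : Factorizes μ F t) (hF : ∀ N T (q : ℕ), MemLp (F N T) q (μ N))
    (hG : ∀ T, ∃ (ι : Type) (_ : Fintype ι) (a : ι → ℂ) (S : ι → TestGraph X),
      (∀ N ω, G N T ω = ∑ k, a k * F N (S k) ω) ∧ s T = ∑ k, a k * t (S k)) :
    Factorizes μ G s := by
  intro I _ T
  choose ι hι a S hGF hst using hG
  -- Expanding the product of sums indexes the terms by choices of one summand per factor; each term
  -- is again a product of values of `F`.
  have h₁ : ∀ N, ∫ ω, ∏ i, G N (T i) ω ∂(μ N) =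
      ∑ x : (∀ i, ι (T i)), (∏ i, a (T i) (x i)) * ∫ ω, ∏ i, F N (S (T i) (x i)) ω ∂(μ N) := by
    intro N
    simp_rw [hGF, Finset.prod_univ_sum, Fintype.piFinset_univ, Finset.prod_mul_distrib]
    rw [integral_finsetSum]
    · simp_rw [integral_const_mul]
    · intro x _
      refine Integrable.const_mul (memLp_one_iff_integrable.1 ?_) _
      simpa using memLp_prod_of_forall univ (fun i _ q => hF N (S (T i) (x i)) q) 1
  simp_rw [h₁, hst, Finset.prod_univ_sum, Fintype.piFinset_univ, Finset.prod_mul_distrib]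
  exact tendsto_finsetSum _ fun x _ => (h I fun i => S (T i) (x i)).const_mul _

theorem Factorizes.injTrace [∀ N, IsFiniteMeasure (μ N)] (hA : HasAllMoments μ A)
    {τ : TestGraph X → ℂ} (h : Factorizes μ (fun N T ω => T.normTrace fun k => A N k ω) τ) :
    Factorizes μ (fun N T ω => 1 / (N : ℂ) * T.injTrace fun k => A N k ω) (injective τ) := by
  refine h.linear (fun N T q => hA.memLp_normTrace T.toStarGraph N q) fun T => ?_
  obtain ⟨ι, hι, a, S, hS⟩ := exists_injective_eq_sum T
  refine ⟨ι, hι, a, S, fun N ω => ?_, hS τ⟩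
  -- The coefficients in `hS` do not depend on the functional, so they serve both for the trace at
  -- fixed N and for the limit `τ`.
  rw [← injective_trace, hS, Finset.mul_sum]
  refine Finset.sum_congr rfl fun k _ => ?_
  unfold StarGraph.normTrace
  ring

theorem Factorizes.normTrace [∀ N, IsFiniteMeasure (μ N)] (hA : HasAllMoments μ A)
    {τ : TestGraph X → ℂ}
    (h : Factorizes μ (fun N T ω => 1 / (N : ℂ) * T.injTrace fun k => A N k ω) (injective τ)) :
    Factorizes μ (fun N T ω => T.normTrace fun k => A N k ω) τ := by
  refine h.linear (fun N T q => (hA.memLp_injTrace T.toStarGraph N q).const_mul _) fun T => ?_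
  refine ⟨Option {π : Setoid T.V // π ≠ ⊥}, inferInstance, fun _ => 1,
    fun k => k.elim T fun π => T.quot π.1, fun N ω => ?_, ?_⟩
  · unfold StarGraph.normTrace
    rw [T.trace_eq_sum_injTrace, Fintype.sum_option, mul_add, Finset.mul_sum]
    simp only [one_mul]
    rfl
  · rw [eq_injective_add_sum τ T, Fintype.sum_option]
    simp

theorem tendsto_one_div_natCast_pow {m : ℕ} (hm : m ≠ 0) :
    Tendsto (fun N : ℕ => (1 / (N : ℂ)) ^ m) atTop (𝓝 0) := by
  have := (tendsto_one_div_atTop_nhds_zero_nat (𝕜 := ℂ)).pow m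
  rwa [zero_pow hm] at this

/-- The injective traces of proper quotients of disjoint unions are negligible. -/
theorem tendsto_injTrace_quot_sigma {t : TestGraph X → ℂ} {I : Type} [Fintype I]
    (S : I → TestGraph X)
    (ih : ∀ (J : Type) [Fintype J] (R : J → TestGraph X), Fintype.card J < Fintype.card I →
      Tendsto (fun N : ℕ => (1 / (N : ℂ)) ^ Fintype.card J *
        ∫ ω, (StarGraph.sigma fun i => (R i).toStarGraph).injTrace (fun k => A N k ω) ∂(μ N)) atTop
        (𝓝 (∏ i, t (R i))))
    {π : Setoid (StarGraph.sigma fun i => (S i).toStarGraph).V} (hπ : π ≠ ⊥)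
    (hs : StarGraph.Separates (fun i => (S i).toStarGraph) π) :
    Tendsto (fun N : ℕ => (1 / (N : ℂ)) ^ Fintype.card I *
      ∫ ω, ((StarGraph.sigma fun i => (S i).toStarGraph).quot π).injTrace (fun k => A N k ω) ∂(μ N))
      atTop (𝓝 0) := by
  have hlt := StarGraph.card_connComp_quot_sigma_lt S hπ hs
  set G := (StarGraph.sigma fun i => (S i).toStarGraph).quot π
  -- The induction hypothesis, normalized by the number of connected components of the quotient,
  -- gives a finite limit; the missing powers of 1/N send the expression to 0.
  have h := (tendsto_one_div_natCast_pow (Nat.sub_ne_zero_of_lt hlt)).mul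
    (ih _ (fun c => G.connComp c) hlt)
  rw [zero_mul] at h
  refine h.congr fun N => ?_
  simp_rw [StarGraph.injTrace_sigma_connComp]
  rw [← mul_assoc, ← pow_add, Nat.sub_add_cancel hlt.le]

theorem integral_prod_injTrace [∀ N, IsFiniteMeasure (μ N)] (hA : HasAllMoments μ A)
    {I : Type} [Fintype I] (S : I → TestGraph X) (N : ℕ) :
    ∫ ω, ∏ i, (1 / (N : ℂ) * (S i).injTrace fun k => A N k ω) ∂(μ N) =
      (1 / (N : ℂ)) ^ Fintype.card I *
        ∫ ω, (StarGraph.sigma fun i => (S i).toStarGraph).injTrace (fun k => A N k ω) ∂(μ N) +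
      ∑ π : {π : Setoid (StarGraph.sigma fun i => (S i).toStarGraph).V //
          π ≠ ⊥ ∧ StarGraph.Separates (fun i => (S i).toStarGraph) π},
        (1 / (N : ℂ)) ^ Fintype.card I *
          ∫ ω, ((StarGraph.sigma fun i => (S i).toStarGraph).quot π.1).injTrace
            (fun k => A N k ω) ∂(μ N) := by
  simp_rw [Finset.prod_mul_distrib, StarGraph.prod_injTrace, Finset.prod_const, Finset.card_univ]
  rw [integral_const_mul, integral_add (hA.integrable_injTrace _ N), integral_finsetSum, mul_add,
    Finset.mul_sum]
  · exact fun π _ => hA.integrable_injTrace _ N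
  · exact integrable_finsetSum _ fun π _ => hA.integrable_injTrace _ N

/-- Strong induction on the number of terms: once the result is known for fewer terms, the
corrections from proper quotients vanish and can be subtracted. -/
theorem Factorizes.sigma [∀ N, IsFiniteMeasure (μ N)] (hA : HasAllMoments μ A)
    {t : TestGraph X → ℂ}
    (h : Factorizes μ (fun N T ω => 1 / (N : ℂ) * T.injTrace fun k => A N k ω) t) :
    SigmaFactorizes μ A t := by
  intro I hI S
  induction hn : Fintype.card I using Nat.strong_induction_on generalizing I with
  | _ n ih =>
    subst hn
    have h₁ := h I S
    simp_rw [integral_prod_injTrace hA] at h₁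
    have h₂ : Tendsto _ _ _ := tendsto_finsetSum univ fun
      (π : {π : Setoid (StarGraph.sigma fun i => (S i).toStarGraph).V //
        π ≠ ⊥ ∧ StarGraph.Separates (fun i => (S i).toStarGraph) π}) _ =>
      tendsto_injTrace_quot_sigma (A := A) (μ := μ) S
        (fun J _ R hJ => ih _ hJ J R rfl) π.2.1 π.2.2
    have h₃ := h₁.sub h₂
    simpa using h₃

/-- The converse needs no induction, since the hypothesis already bounds all the corrections. -/
theorem SigmaFactorizes.factorizes [∀ N, IsFiniteMeasure (μ N)] (hA : HasAllMoments μ A)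
    {t : TestGraph X → ℂ} (h : SigmaFactorizes μ A t) :
    Factorizes μ (fun N T ω => 1 / (N : ℂ) * T.injTrace fun k => A N k ω) t := by
  intro I _ S
  simp_rw [integral_prod_injTrace hA]
  have h₂ : Tendsto _ _ _ := tendsto_finsetSum univ fun
      (π : {π : Setoid (StarGraph.sigma fun i => (S i).toStarGraph).V //
        π ≠ ⊥ ∧ StarGraph.Separates (fun i => (S i).toStarGraph) π}) _ =>
      tendsto_injTrace_quot_sigma (A := A) (μ := μ) S
        (fun J _ R _ => h J R) π.2.1 π.2.2
  simpa using (h I S).add h₂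

/-- Injective traces of disjoint unions determine the decorrelation property. -/
theorem SigmaFactorizes.exists_decorrelated [∀ N, IsFiniteMeasure (μ N)] (hA : HasAllMoments μ A)
    {t : TestGraph X → ℂ} (h : SigmaFactorizes μ A t) :
    ∃ τ : TestGraph X → ℂ, (∀ T, injective τ T = t T) ∧ Decorrelated μ A τ := by
  refine ⟨fun T => t T + ∑ π : {π : Setoid T.V // π ≠ ⊥}, t (T.quot π.1),
    injective_eq_of_forall fun _ => rfl, fun n T => ?_⟩
  have h' := h.factorizes hA
  rw [← funext (injective_eq_of_forall (t := t) fun _ => rfl)] at h'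
  exact h'.normTrace hA (Fin n) T

theorem Decorrelated.sigmaFactorizes [∀ N, IsFiniteMeasure (μ N)] (hA : HasAllMoments μ A)
    {τ : TestGraph X → ℂ} (h : Decorrelated μ A τ) : SigmaFactorizes μ A (injective τ) :=
  (h.factorizes.injTrace hA).sigma hA

theorem Decorrelated.convergesInTraffics {τ : TestGraph X → ℂ} (h : Decorrelated μ A τ) :
    ConvergesInTraffics μ A τ := fun T => by
  simpa using h 1 fun _ => T

theorem Decorrelated.tendsto_injTrace [∀ N, IsFiniteMeasure (μ N)] (hA : HasAllMoments μ A)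
    {τ : TestGraph X → ℂ} (h : Decorrelated μ A τ) (T : TestGraph X) :
    Tendsto (fun N => ∫ ω, 1 / (N : ℂ) * T.injTrace (fun k => A N k ω) ∂(μ N)) atTop
      (𝓝 (injective τ T)) := by
  simpa using h.factorizes.injTrace hA Unit fun _ => T

end

/-! ### Restriction to one family of variables -/

namespace StarGraph

variable {p : ℕ} {K : Fin p → Type u}

/-- The graph with the same vertices, keeping only the edges labelled in the family `j`. -/
def restrict (T : StarGraph (Σ j, K j)) (j : Fin p) : StarGraph (K j) where
  V := T.V
  E := {e // (T.label e).1 = j}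
  src := fun e => T.src e.1
  tgt := fun e => T.tgt e.1
  label := fun e => e.2 ▸ (T.label e.1).2
  star := fun e => T.star e.1

theorem entry_restrict {N : ℕ} (T : StarGraph (Σ j, K j)) (A : ∀ j, K j → Matrix (Fin N) (Fin N) ℂ)
    (j : Fin p) (e : (T.restrict j).E) :
    (T.restrict j).entry (A j) e = T.entry (fun x => A x.1 x.2) e.1 := by
  have key : ∀ (x : Σ j, K j) (h : x.1 = j), A j (h ▸ x.2) = A x.1 x.2 := by
    rintro x rfl
    rfl
  have h := key (T.label e.1) e.2
  unfold entry
  change (if T.star e.1 then (A j (e.2 ▸ (T.label e.1).2)).conjTranspose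
    else A j (e.2 ▸ (T.label e.1).2)) = _
  rw [h]

theorem weight_eq_prod_restrict {N : ℕ} (T : StarGraph (Σ j, K j))
    (A : ∀ j, K j → Matrix (Fin N) (Fin N) ℂ) (φ : T.V → Fin N) :
    T.weight (fun x => A x.1 x.2) φ = ∏ j, (T.restrict j).weight (A j) φ := by
  unfold weight
  simp_rw [entry_restrict]
  rw [← Fintype.prod_fiberwise (fun e : T.E => (T.label e).1)]
  rfl

end StarGraph

namespace TestGraph

theorem subsingleton_of_isEmpty {X : Type*} (T : TestGraph X) [IsEmpty T.E] :
    Subsingleton T.V := by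
  refine ⟨fun v w => ?_⟩
  induction T.connected.2 v w with
  | rel x y h => exact isEmptyElim h.choose
  | refl x => rfl
  | symm x y _ ih => exact ih.symm
  | trans x y z _ _ ih₁ ih₂ => exact ih₁.trans ih₂

theorem card_eq_one_of_isEmpty {X : Type*} (T : TestGraph X) [IsEmpty T.E] :
    Fintype.card T.V = 1 := by
  have := T.subsingleton_of_isEmpty
  obtain ⟨v⟩ := T.connected.1
  exact Fintype.card_eq_one_iff.2 ⟨v, fun w => Subsingleton.elim _ _⟩

variable {p : ℕ} {K : Fin p → Type u} (S : TestGraph (Σ j, K j))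

/-- The vertex `v` is an endpoint of the edge `e`. -/
def Touches (e : S.E) (v : S.V) : Prop := S.src e = v ∨ S.tgt e = v

variable {S} in
theorem compOf_eq {e f : S.E} {v : S.V} (h : (S.label e).1 = (S.label f).1) (he : S.Touches e v)
    (hf : S.Touches f v) : S.compOf e = S.compOf f := by
  refine Quot.sound ⟨h, ?_⟩
  rcases he with rfl | rfl <;> rcases hf with hf | hf <;> simp [hf]

/-- The components in the family `j` that meet a connected component of the restriction of `S` to
this family. -/
def compSet (j : Fin p) : Quot (S.restrict j).Linked → Set S.Comp :=
  Quot.lift (fun v => {c | ∃ e, (S.label e).1 = j ∧ S.compOf e = c ∧ S.Touches e v}) <| by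
    rintro v w ⟨⟨g, hg⟩, rfl, rfl⟩
    ext c
    constructor
    · rintro ⟨e, rfl, rfl, he⟩
      exact ⟨g, hg, compOf_eq hg (.inl rfl) he, .inr rfl⟩
    · rintro ⟨e, rfl, rfl, he⟩
      exact ⟨g, hg, compOf_eq hg (.inr rfl) he, .inl rfl⟩

theorem compSet_subsingleton (j : Fin p) (d : Quot (S.restrict j).Linked) :
    (S.compSet j d).Subsingleton := by
  obtain ⟨v, rfl⟩ := Quot.exists_rep d
  rintro _ ⟨e, he, rfl, hev⟩ _ ⟨f, hf, rfl, hfv⟩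
  exact compOf_eq (he.trans hf.symm) hev hfv

theorem mk_src_eq_mk_tgt {j : Fin p} {e : S.E} (h : (S.label e).1 = j) :
    Quot.mk (S.restrict j).Linked (S.src e) = Quot.mk (S.restrict j).Linked (S.tgt e) :=
  Quot.sound ⟨⟨e, h⟩, rfl, rfl⟩

theorem mk_eq_of_touches {j : Fin p} {e : S.E} {v : S.V} (h : (S.label e).1 = j)
    (hv : S.Touches e v) :
    Quot.mk (S.restrict j).Linked (S.src e) = Quot.mk (S.restrict j).Linked v := by
  rcases hv with rfl | rfl
  · rfl
  · exact S.mk_src_eq_mk_tgt h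

/-- A component of `S` as a connected component of the restriction of `S` to some family. -/
def compClass : S.Comp → Σ j, Quot (S.restrict j).Linked :=
  Quot.lift (fun e => ⟨(S.label e).1, Quot.mk (S.restrict _).Linked (S.src e)⟩) <| by
    rintro e f ⟨h, hv⟩
    have key : ∀ j, (S.label e).1 = j → (S.label f).1 = j →
        (⟨j, Quot.mk _ (S.src e)⟩ : Σ j, Quot (S.restrict j).Linked) =
          ⟨j, Quot.mk _ (S.src f)⟩ := by
      intro j he hf
      congr 1
      have h₁ := S.mk_src_eq_mk_tgt he
      have h₂ := S.mk_src_eq_mk_tgt hf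
      rcases hv with hv | hv | hv | hv
      · rw [hv]
      · rw [hv, h₂]
      · rw [h₁, hv]
      · rw [h₁, hv, h₂]
    rw [key _ rfl h.symm]
    have : ∀ j, j = (S.label f).1 →
        (⟨j, Quot.mk _ (S.src f)⟩ : Σ j, Quot (S.restrict j).Linked) =
          ⟨(S.label f).1, Quot.mk _ (S.src f)⟩ := by
      rintro _ rfl
      rfl
    exact this _ h

theorem compClass_compOf {j : Fin p} {e : S.E} (h : (S.label e).1 = j) :
    S.compClass (S.compOf e) = ⟨j, Quot.mk _ (S.src e)⟩ := by
  subst h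
  rfl

theorem compClass_eq_iff {c : S.Comp} {j : Fin p} {d : Quot (S.restrict j).Linked} :
    S.compClass c = ⟨j, d⟩ ↔ c ∈ S.compSet j d := by
  constructor
  · obtain ⟨e, rfl⟩ := Quot.exists_rep c
    intro h
    obtain ⟨rfl, h⟩ := Sigma.mk.inj h
    rw [← eq_of_heq h]
    exact ⟨e, rfl, rfl, .inl rfl⟩
  · obtain ⟨v, rfl⟩ := Quot.exists_rep d
    rintro ⟨e, he, rfl, hv⟩
    rw [S.compClass_compOf he, S.mk_eq_of_touches he hv]

theorem compClass_injective : Function.Injective S.compClass := by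
  intro c c' h
  refine S.compSet_subsingleton (S.compClass c).1 (S.compClass c).2 ?_ ?_
  · rw [← compClass_eq_iff]
  · rw [← compClass_eq_iff, ← h]

variable {S} in
theorem compOf_eq_iff {c : S.Comp} {j : Fin p} {d : Quot (S.restrict j).Linked}
    (h : S.compClass c = ⟨j, d⟩) (e : S.E) :
    S.compOf e = c ↔ (S.label e).1 = j ∧ Quot.mk (S.restrict j).Linked (S.src e) = d := by
  constructor
  · rintro rfl
    obtain ⟨rfl, h⟩ := Sigma.mk.inj h
    exact ⟨rfl, eq_of_heq h⟩
  · rintro ⟨rfl, rfl⟩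
    exact S.compClass_injective h.symm

variable {S} in
theorem memComp_iff {c : S.Comp} {j : Fin p} {d : Quot (S.restrict j).Linked}
    (h : S.compClass c = ⟨j, d⟩) (v : S.V) :
    S.MemComp v c ↔ Quot.mk (S.restrict j).Linked v = d := by
  constructor
  · rintro ⟨e, he, hv⟩
    obtain ⟨hj, hd⟩ := (compOf_eq_iff h e).1 he
    rw [← S.mk_eq_of_touches hj hv, hd]
  · rintro rfl
    obtain ⟨e, -, he, hv⟩ := (S.compClass_eq_iff).1 h
    exact ⟨e, he, hv⟩

/-- The vertices of a component are those of the corresponding connected component. -/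
def compVertexEquiv {c : S.Comp} {j : Fin p} {d : Quot (S.restrict j).Linked}
    (h : S.compClass c = ⟨j, d⟩) : (S.comp c).V ≃ ((S.restrict j).connComp d).V :=
  Equiv.subtypeEquivRight (memComp_iff h)

/-- The edges of a component are those of the corresponding connected component. -/
def compEdgeEquiv {c : S.Comp} {j : Fin p} {d : Quot (S.restrict j).Linked}
    (h : S.compClass c = ⟨j, d⟩) : (S.comp c).E ≃ ((S.restrict j).connComp d).E where
  toFun e := ⟨⟨e.1, ((compOf_eq_iff h e.1).1 e.2).1⟩, ((compOf_eq_iff h e.1).1 e.2).2⟩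
  invFun e := ⟨e.1.1, (compOf_eq_iff h e.1.1).2 ⟨e.1.2, e.2⟩⟩
  left_inv _ := rfl
  right_inv _ := rfl

theorem injTrace_comp {N : ℕ} (A : ∀ j, K j → Matrix (Fin N) (Fin N) ℂ) {c : S.Comp} {j : Fin p}
    {d : Quot (S.restrict j).Linked} (h : S.compClass c = ⟨j, d⟩) :
    (S.comp c).injTrace (fun x => A x.1 x.2) = ((S.restrict j).connComp d).injTrace (A j) :=
  StarGraph.injTrace_congr (S.compVertexEquiv h) (S.compEdgeEquiv h) (fun _ => rfl) (fun _ => rfl)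
    fun e => S.entry_restrict A j ((S.compEdgeEquiv h) e).1

/-- A connected component of a restriction that is not a component of `S` is an isolated vertex.
Such pieces are invisible in the counting and contribute 1 to the limit. -/
theorem isEmpty_connComp_edges {j : Fin p} {d : Quot (S.restrict j).Linked}
    (h : (⟨j, d⟩ : Σ j, Quot (S.restrict j).Linked) ∉ Set.range S.compClass) :
    IsEmpty ((S.restrict j).connComp d).E := by
  refine ⟨fun e => h ⟨S.compOf e.1.1, ?_⟩⟩
  rw [S.compClass_compOf e.1.2]
  exact congrArg _ e.2

/-! ### Counting -/

/-- Sum (number of vertices - 1) over all connected components of all restrictions. Isolated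
vertices contribute 0, so the same sum may be taken over the components of `S`; the statement
equates the two, without subtraction. -/
theorem card_mul_add_card_comp :
    p * Fintype.card S.V + Fintype.card S.Comp =
      ∑ j, Fintype.card (Quot (S.restrict j).Linked) +
        ∑ c : S.Comp, Fintype.card (S.comp c).V := by
  have hpos : ∀ G : TestGraph (Σ j, K j), 1 ≤ Fintype.card G.V :=
    fun G => Fintype.card_pos_iff.2 G.connected.1
  have hpos' : ∀ j (d : Quot (S.restrict j).Linked),
      1 ≤ Fintype.card ((S.restrict j).connComp d).V :=
    fun j d => Fintype.card_pos_iff.2 ((S.restrict j).connComp d).connected.1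
  have h₁ : ∀ j, ∑ d : Quot (S.restrict j).Linked, Fintype.card ((S.restrict j).connComp d).V
      = Fintype.card S.V := by
    intro j
    rw [← Fintype.card_sigma]
    exact Fintype.card_congr (Equiv.sigmaFiberEquiv (Quot.mk (S.restrict j).Linked))
  have h₂ : ∑ c : S.Comp, (Fintype.card (S.comp c).V - 1) =
      ∑ q : (Σ j, Quot (S.restrict j).Linked),
        (Fintype.card ((S.restrict q.1).connComp q.2).V - 1) := by
    refine Fintype.sum_of_injective S.compClass S.compClass_injective _ _ ?_ ?_
    · rintro ⟨j, d⟩ hq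
      have := S.isEmpty_connComp_edges hq
      have := ((S.restrict j).connComp d).subsingleton_of_isEmpty
      exact Nat.sub_eq_zero_of_le (Fintype.card_le_one_iff_subsingleton.2 this)
    · intro c
      exact congrArg (· - 1) (Fintype.card_congr (S.compVertexEquiv (c := c) rfl))
  have h₃ : ∑ c : S.Comp, (Fintype.card (S.comp c).V - 1) + Fintype.card S.Comp =
      ∑ c : S.Comp, Fintype.card (S.comp c).V := by
    rw [← Finset.card_univ, Finset.card_eq_sum_ones, ← Finset.sum_add_distrib]
    exact Finset.sum_congr rfl fun c _ => Nat.sub_add_cancel (hpos _)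
  have h₄ : ∑ q : (Σ j, Quot (S.restrict j).Linked),
        (Fintype.card ((S.restrict q.1).connComp q.2).V - 1) +
      ∑ j, Fintype.card (Quot (S.restrict j).Linked) = p * Fintype.card S.V := by
    rw [← Fintype.card_sigma, ← Finset.card_univ, Finset.card_eq_sum_ones,
      ← Finset.sum_add_distrib]
    rw [Finset.sum_congr rfl fun q _ => Nat.sub_add_cancel (hpos' q.1 q.2), Fintype.sum_sigma]
    simp [h₁]
  omega

instance : Finite S.CommonVertex := Subtype.finite

instance : Fintype S.CommonVertex := Fintype.ofFinite _

variable {S} in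
theorem componentGraph_adj {c : S.Comp} {v : S.CommonVertex} (h : S.MemComp v.1 c) :
    S.componentGraph.Adj (.inl c) (.inr v) := by
  rw [componentGraph, SimpleGraph.fromRel_adj]
  exact ⟨by simp, .inl ⟨c, v, rfl, rfl, h⟩⟩

theorem card_edgeSet_componentGraph :
    Nat.card S.componentGraph.edgeSet =
      ∑ v : S.CommonVertex, Fintype.card {c // S.MemComp v.1 c} := by
  rw [← Fintype.card_sigma, ← Nat.card_eq_fintype_card]
  symm
  let f : (Σ v : S.CommonVertex, {c // S.MemComp v.1 c}) → S.componentGraph.edgeSet :=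
    fun x => ⟨s(.inl x.2.1, .inr x.1), componentGraph_adj x.2.2⟩
  refine Nat.card_eq_of_bijective f ⟨?_, ?_⟩
  · rintro ⟨v, c, hc⟩ ⟨v', c', hc'⟩ h
    have h := Subtype.ext_iff.1 h
    simp only [f, Sym2.eq_iff, Sum.inl.injEq, Sum.inr.injEq, reduceCtorEq, and_self, or_false] at h
    obtain ⟨rfl, rfl⟩ := h
    rfl
  · rintro ⟨x, hx⟩
    induction x using Sym2.ind with
    | _ a b =>
      have hx' : S.componentGraph.Adj a b := hx
      rw [componentGraph, SimpleGraph.fromRel_adj] at hx'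
      obtain ⟨-, ⟨c, v, rfl, rfl, h⟩ | ⟨c, v, rfl, rfl, h⟩⟩ := hx'
      · exact ⟨⟨v, c, h⟩, rfl⟩
      · exact ⟨⟨v, c, h⟩, Subtype.ext Sym2.eq_swap⟩

theorem exists_touches [Nonempty S.E] (v : S.V) : ∃ e, S.Touches e v := by
  obtain ⟨e₀⟩ := ‹Nonempty S.E›
  have : (∃ e, S.Touches e v) ↔ ∃ e, S.Touches e (S.src e₀) := by
    generalize S.src e₀ = w
    induction S.connected.2 v w with
    | rel x y h =>
      obtain ⟨e, rfl, rfl⟩ := h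
      exact ⟨fun _ => ⟨e, .inr rfl⟩, fun _ => ⟨e, .inl rfl⟩⟩
    | refl x => exact Iff.rfl
    | symm x y _ ih => exact ih.symm
    | trans x y z _ _ ih₁ ih₂ => exact ih₁.trans ih₂
  exact this.2 ⟨e₀, .inl rfl⟩

/-- Count the incidences between vertices and components. At common vertices these are the edges of
the component graph; every other vertex lies in exactly one component, as it touches an edge. -/
theorem sum_card_comp_add_card_commonVertex [Nonempty S.E] :
    ∑ c : S.Comp, Fintype.card (S.comp c).V + Fintype.card S.CommonVertex =
      Nat.card S.componentGraph.edgeSet + Fintype.card S.V := by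
  let P : S.V → Prop := fun v => ∃ c c', c ≠ c' ∧ S.MemComp v c ∧ S.MemComp v c'
  have h₁ : ∑ c : S.Comp, Fintype.card (S.comp c).V =
      ∑ v : S.V, Fintype.card {c // S.MemComp v c} := by
    rw [← Fintype.card_sigma, ← Fintype.card_sigma]
    exact Fintype.card_congr
      { toFun := fun x => ⟨x.2.1, x.1, x.2.2⟩
        invFun := fun x => ⟨x.2.1, x.1, x.2.2⟩
        left_inv := fun _ => rfl
        right_inv := fun _ => rfl }
  have h₂ : ∀ v, ¬ P v → Fintype.card {c // S.MemComp v c} = 1 := by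
    intro v hv
    obtain ⟨e, he⟩ := S.exists_touches v
    refine Fintype.card_eq_one_iff.2 ⟨⟨S.compOf e, e, rfl, he⟩, fun c => Subtype.ext ?_⟩
    by_contra hc
    exact hv ⟨_, _, hc, c.2, e, rfl, he⟩
  have h₃ : ∑ v : S.V with P v, Fintype.card {c // S.MemComp v c} =
      ∑ v : S.CommonVertex, Fintype.card {c // S.MemComp v.1 c} :=
    Finset.sum_subtype _ (fun v => by simp [P]) _
  have h₄ : Fintype.card S.CommonVertex = #{v : S.V | P v} := by
    rw [← Nat.card_eq_fintype_card]
    exact Nat.subtype_card _ (by simp [P])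
  have h₅ : #{v : S.V | P v} + #{v : S.V | ¬ P v} = Fintype.card S.V :=
    Finset.card_filter_add_card_filter_not _
  rw [h₁, S.card_edgeSet_componentGraph, ← h₃, ← Finset.sum_filter_add_sum_filter_not univ P,
    Finset.sum_congr rfl fun v hv => h₂ v (mem_filter.1 hv).2, Finset.sum_const, smul_eq_mul, mul_one,
    h₄, ← h₅]
  ring

theorem componentGraph_connected [Nonempty S.E] : S.componentGraph.Connected := by
  have hv : ∀ (v : S.V) (e f : S.E), S.Touches e v → S.Touches f v →
      S.componentGraph.Reachable (.inl (S.compOf e)) (.inl (S.compOf f)) := by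
    intro v e f he hf
    by_cases h : S.compOf e = S.compOf f
    · rw [h]
    · have hme : S.MemComp v (S.compOf e) := ⟨e, rfl, he⟩
      have hmf : S.MemComp v (S.compOf f) := ⟨f, rfl, hf⟩
      let x : S.CommonVertex := ⟨v, _, _, h, hme, hmf⟩
      exact (componentGraph_adj (v := x) hme).reachable.trans
        (componentGraph_adj (v := x) hmf).symm.reachable
  have key : ∀ v w : S.V, ∀ e f : S.E, S.Touches e v → S.Touches f w →
      S.componentGraph.Reachable (.inl (S.compOf e)) (.inl (S.compOf f)) := by
    intro v w
    induction S.connected.2 v w with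
    | rel x y h =>
      obtain ⟨g, rfl, rfl⟩ := h
      intro e f he hf
      exact (hv _ e g he (.inl rfl)).trans (hv _ g f (.inr rfl) hf)
    | refl x => exact hv x
    | symm x y _ ih => exact fun e f he hf => (ih f e hf he).symm
    | trans x y z _ _ ih₁ ih₂ =>
      intro e f he hf
      obtain ⟨g, hg⟩ := S.exists_touches y
      exact (ih₁ e g he hg).trans (ih₂ g f hg hf)
  have hc : ∀ c c' : S.Comp, S.componentGraph.Reachable (.inl c) (.inl c') := by
    intro c c'
    obtain ⟨e, rfl⟩ := Quot.exists_rep c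
    obtain ⟨f, rfl⟩ := Quot.exists_rep c'
    exact key _ _ e f (.inl rfl) (.inl rfl)
  have hr : ∀ a, ∃ c, S.componentGraph.Reachable a (.inl c) := by
    rintro (c | ⟨v, c, c', h, h₁, h₂⟩)
    · exact ⟨c, .refl _⟩
    · exact ⟨c, (componentGraph_adj (v := ⟨v, c, c', h, h₁, h₂⟩) h₁).symm.reachable⟩
  have : Nonempty (S.Comp ⊕ S.CommonVertex) := ‹Nonempty S.E›.map fun e => .inl (S.compOf e)
  refine ⟨fun a b => ?_⟩
  obtain ⟨c, h⟩ := hr a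
  obtain ⟨c', h'⟩ := hr b
  exact h.trans ((hc c c').trans h'.symm)

theorem card_connComp_of_isEmpty [IsEmpty S.E] (j : Fin p) :
    Fintype.card (Quot (S.restrict j).Linked) = 1 := by
  have := S.subsingleton_of_isEmpty
  obtain ⟨v⟩ := S.connected.1
  refine Fintype.card_eq_one_iff.2 ⟨Quot.mk _ v, fun d => ?_⟩
  obtain ⟨w, rfl⟩ := Quot.exists_rep d
  exact congrArg _ (Subsingleton.elim (α := S.V) _ _)

/-- The total number of connected components of the restrictions of a connected graph. -/
theorem card_add_sum_card_connComp_le :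
    Fintype.card S.V + ∑ j, Fintype.card (Quot (S.restrict j).Linked) ≤
      1 + p * Fintype.card S.V := by
  rcases isEmpty_or_nonempty S.E with h | h
  · simp [S.card_eq_one_of_isEmpty, S.card_connComp_of_isEmpty]
  · have h₁ := S.componentGraph_connected.card_vert_le_card_edgeSet_add_one
    rw [Nat.card_eq_fintype_card, Fintype.card_sum] at h₁
    have h₂ := S.sum_card_comp_add_card_commonVertex
    have h₃ := S.card_mul_add_card_comp
    -- The difference of the two sides equals edges + 1 - vertices for the component graph, which is
    -- connected.
    omega

/-- The equality case characterizes free products. -/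
theorem isFreeProduct_iff :
    S.IsFreeProduct ↔ Fintype.card S.V + ∑ j, Fintype.card (Quot (S.restrict j).Linked) =
      1 + p * Fintype.card S.V := by
  rcases isEmpty_or_nonempty S.E with h | h
  · simp [S.card_eq_one_of_isEmpty, S.card_connComp_of_isEmpty, IsFreeProduct, h]
  · have h₂ := S.sum_card_comp_add_card_commonVertex
    have h₃ := S.card_mul_add_card_comp
    rw [IsFreeProduct, SimpleGraph.isTree_iff_connected_and_card,
      Nat.card_eq_fintype_card (α := _ ⊕ _), Fintype.card_sum, or_iff_right (not_isEmpty_iff.2 h),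
      and_iff_right S.componentGraph_connected]
    constructor <;> intro <;> omega

end TestGraph

/-! ### Independence and invariance under permutations -/

theorem measurable_weight {X : Type*} (T : StarGraph X) {N : ℕ} (φ : T.V → Fin N) :
    Measurable fun B : X → Fin N → Fin N → ℂ => T.weight (fun k => Matrix.of (B k)) φ := by
  unfold StarGraph.weight
  refine Finset.measurable_fun_prod _ fun e _ => ?_
  have h : ∀ (k : X) (a b : Fin N), Measurable fun B : X → Fin N → Fin N → ℂ => B k a b :=
    fun k a b => (measurable_pi_apply b).comp ((measurable_pi_apply a).comp (measurable_pi_apply k))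
  unfold StarGraph.entry
  split_ifs
  · exact continuous_star.measurable.comp (h _ _ _)
  · exact h _ _ _

theorem exists_perm_comp_eq {V : Type*} [Fintype V] {N : ℕ} {φ ψ : V → Fin N}
    (hφ : Function.Injective φ) (hψ : Function.Injective ψ) :
    ∃ σ : Equiv.Perm (Fin N), σ ∘ φ = ψ := by
  let e := Fintype.equivFin V
  have := Equiv.Perm.isMultiplyPretransitive (Fin N) (Fintype.card V)
  obtain ⟨σ, hσ⟩ := MulAction.exists_smul_eq (Equiv.Perm (Fin N))
    (e.symm.toEmbedding.trans ⟨φ, hφ⟩) (e.symm.toEmbedding.trans ⟨ψ, hψ⟩)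
  refine ⟨σ, funext fun v => ?_⟩
  simpa using DFunLike.congr_fun hσ (e v)

section

variable {Ω : ℕ → Type*} [∀ N, MeasurableSpace (Ω N)] {μ : ∀ N, Measure (Ω N)}

theorem HasAllMoments.measurable {X : Type u} {A : ∀ N, X → Ω N → Matrix (Fin N) (Fin N) ℂ}
    (hA : HasAllMoments μ A) (N : ℕ) :
    Measurable (fun ω k a b => A N k ω a b : Ω N → X → Fin N → Fin N → ℂ) :=
  measurable_pi_lambda _ fun k => measurable_pi_lambda _ fun a => measurable_pi_lambda _ fun b =>
    (hA N k a b).1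

theorem permMatrix_conj_apply {N : ℕ} (σ : Equiv.Perm (Fin N)) (M : Matrix (Fin N) (Fin N) ℂ)
    (a b : Fin N) :
    (σ.permMatrix ℂ * M * (σ.permMatrix ℂ).conjTranspose) a b = M (σ a) (σ b) := by
  rw [Matrix.conjTranspose_permMatrix, Equiv.Perm.permMatrix, Equiv.Perm.permMatrix,
    PEquiv.toMatrix_toPEquiv_mul, PEquiv.mul_toMatrix_toPEquiv]
  rfl

/-- Permutations act transitively on injective maps of a given vertex set, so the expected weight
takes one value on all of them. -/
theorem PermInvariant.integral_weight {X : Type u} {A : ∀ N, X → Ω N → Matrix (Fin N) (Fin N) ℂ}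
    (hA : HasAllMoments μ A) (h : PermInvariant μ A) (T : StarGraph X) {N : ℕ}
    {φ ψ : T.V → Fin N} (hφ : Function.Injective φ) (hψ : Function.Injective ψ) :
    ∫ ω, T.weight (fun k => A N k ω) φ ∂(μ N) = ∫ ω, T.weight (fun k => A N k ω) ψ ∂(μ N) := by
  obtain ⟨σ, rfl⟩ := exists_perm_comp_eq hφ hψ
  have h₁ := h N σ
  have hm := measurable_weight T φ
  have hσ : Measurable (fun ω k a b => A N k ω (σ a) (σ b) : Ω N → X → Fin N → Fin N → ℂ) :=
    measurable_pi_lambda _ fun k => measurable_pi_lambda _ fun a => measurable_pi_lambda _ fun b =>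
      (hA N k (σ a) (σ b)).1
  simp_rw [permMatrix_conj_apply] at h₁
  have h₂ := congrArg (fun ν => ∫ B, T.weight (fun k => Matrix.of (B k)) φ ∂ν) h₁
  rw [integral_map hσ.aemeasurable hm.aestronglyMeasurable,
    integral_map (hA.measurable N).aemeasurable hm.aestronglyMeasurable] at h₂
  rw [show (fun ω => T.weight (fun k => A N k ω) φ) = fun ω =>
    T.weight (fun k => Matrix.of fun a b => A N k ω a b) φ from rfl, ← h₂]
  refine integral_congr_ae (.of_forall fun ω => ?_)
  refine Finset.prod_congr rfl fun e _ => ?_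
  unfold StarGraph.entry
  split_ifs <;> rfl

/-- All factors but at most one are constant on `F`, so each constant equals its average and pulls
out; the remaining factor is summed. -/
theorem sum_prod_eq_of_subsingleton {α : Type*} {p : ℕ} (F : Finset α) (x : Fin p → α → ℂ)
    (h : {j | ¬ ∀ a ∈ F, ∀ b ∈ F, x j a = x j b}.Subsingleton) :
    ∑ a ∈ F, ∏ j, x j a = (#F : ℂ) * ∏ j, ((∑ a ∈ F, x j a) / (#F : ℂ)) := by
  rcases F.eq_empty_or_nonempty with rfl | ⟨b, hb⟩
  · simp
  have hF : (#F : ℂ) ≠ 0 := Nat.cast_ne_zero.2 (Finset.card_ne_zero_of_mem hb)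
  have hc : ∀ j, (∀ a ∈ F, ∀ b ∈ F, x j a = x j b) → (∑ a ∈ F, x j a) / (#F : ℂ) = x j b := by
    intro j hj
    rw [Finset.sum_congr rfl fun a ha => hj a ha b hb, Finset.sum_const, nsmul_eq_mul,
      mul_div_cancel_left₀ _ hF]
  by_cases hall : ∀ j, ∀ a ∈ F, ∀ b ∈ F, x j a = x j b
  · rw [Finset.prod_congr rfl fun j _ => hc j (hall j),
      Finset.sum_congr rfl fun a ha => Finset.prod_congr rfl fun j _ => hall j a ha b hb,
      Finset.sum_const, nsmul_eq_mul]
  · push Not at hall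
    obtain ⟨i, hi⟩ := hall
    have hi : ¬ ∀ a ∈ F, ∀ b ∈ F, x i a = x i b := by push Not; exact hi
    have hj : ∀ j ∈ univ.erase i, ∀ a ∈ F, ∀ b ∈ F, x j a = x j b := by
      intro j hj
      by_contra hne
      exact (mem_erase.1 hj).1 (h hne hi)
    rw [← Finset.mul_prod_erase _ _ (mem_univ i),
      Finset.prod_congr rfl fun j hje => hc j (hj j hje), ← mul_assoc, mul_div_cancel₀ _ hF,
      Finset.sum_mul]
    refine Finset.sum_congr rfl fun a ha => ?_
    rw [← Finset.mul_prod_erase _ _ (mem_univ i),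
      Finset.prod_congr rfl fun j hje => hj j hje a ha b hb]

theorem card_filter_injective (V : Type*) [Fintype V] (N : ℕ) :
    #{φ : V → Fin N | Function.Injective φ} = N.descFactorial (Fintype.card V) := by
  rw [← Fintype.card_subtype, Fintype.card_congr (Equiv.subtypeInjectiveEquivEmbedding V (Fin N)),
    Fintype.card_embedding_eq, Fintype.card_fin]

variable {p : ℕ} {K : Fin p → Type u} {A : ∀ N, ∀ j : Fin p, K j → Ω N → Matrix (Fin N) (Fin N) ℂ}

theorem hasAllMoments_sigma (hmom : ∀ j, HasAllMoments μ (fun N => A N j)) :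
    HasAllMoments μ (fun N (x : Σ j, K j) => A N x.1 x.2) :=
  fun N x a b => hmom x.1 N x.2 a b

/-- The expected injective trace of independent families all of which but one are invariant under
permutations. -/
theorem integral_injTrace_eq [∀ N, IsProbabilityMeasure (μ N)]
    (hmom : ∀ j, HasAllMoments μ (fun N => A N j))
    (hindep : ∀ N, iIndepFun
      (fun j ω k a b => A N j k ω a b : ∀ j : Fin p, Ω N → K j → Fin N → Fin N → ℂ) (μ N))
    (hperm : {j : Fin p | ¬ PermInvariant μ (fun N => A N j)}.Subsingleton)
    (T : StarGraph (Σ j, K j)) (N : ℕ) :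
    ∫ ω, T.injTrace (fun x => A N x.1 x.2 ω) ∂(μ N) =
      (N.descFactorial (Fintype.card T.V) : ℂ) *
        ∏ j, ((∫ ω, (T.restrict j).injTrace (fun k => A N j k ω) ∂(μ N)) /
          (N.descFactorial (Fintype.card T.V) : ℂ)) := by
  have hint : ∀ {Y : Type u} {B : ∀ N, Y → Ω N → Matrix (Fin N) (Fin N) ℂ} (_ : HasAllMoments μ B)
      (G : StarGraph Y), ∫ ω, G.injTrace (fun k => B N k ω) ∂(μ N) =
        ∑ φ : G.V → Fin N with Function.Injective φ,
          ∫ ω, G.weight (fun k => B N k ω) φ ∂(μ N) := by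
    intro Y B hB G
    refine integral_finsetSum _ fun φ _ => memLp_one_iff_integrable.1 ?_
    simpa using hB.memLp_weight G N φ 1
  have hprod : ∀ φ : T.V → Fin N, ∫ ω, T.weight (fun x => A N x.1 x.2 ω) φ ∂(μ N) =
      ∏ j, ∫ ω, (T.restrict j).weight (fun k => A N j k ω) φ ∂(μ N) := by
    intro φ
    have h₁ := (hindep N).comp
      (fun j (B : K j → Fin N → Fin N → ℂ) => (T.restrict j).weight (fun k => Matrix.of (B k)) φ)
      (fun j => measurable_weight (T.restrict j) φ)
    have h₂ := h₁.integral_fun_prod_eq_prod_integral fun j =>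
      ((measurable_weight (T.restrict j) φ).comp ((hmom j).measurable N)).aestronglyMeasurable
    refine Eq.trans (integral_congr_ae (.of_forall fun ω => ?_)) h₂
    exact T.weight_eq_prod_restrict (fun j k => A N j k ω) φ
  rw [hint (hasAllMoments_sigma hmom)]
  simp_rw [hprod]
  rw [← card_filter_injective, sum_prod_eq_of_subsingleton]
  · congr 1
    exact Finset.prod_congr rfl fun j _ => by rw [hint (hmom j) (T.restrict j)]; rfl
  · refine hperm.anti fun j hj hinv => hj fun φ hφ ψ hψ => ?_
    exact hinv.integral_weight (hmom j) (T.restrict j) (mem_filter.1 hφ).2 (mem_filter.1 hψ).2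

/-! ### Asymptotics -/

theorem tendsto_descFactorial_div_pow (m : ℕ) :
    Tendsto (fun N : ℕ => (N.descFactorial m : ℂ) / (N : ℂ) ^ m) atTop (𝓝 1) := by
  induction m with
  | zero => simp
  | succ m ih =>
    have h : Tendsto (fun N : ℕ => ((N - m : ℕ) : ℂ) / (N : ℂ)) atTop (𝓝 1) := by
      have h₁ := (tendsto_one_div_atTop_nhds_zero_nat (𝕜 := ℂ)).const_mul (m : ℂ)
      have h₂ := h₁.const_sub 1
      rw [mul_zero, sub_zero] at h₂
      refine h₂.congr' ?_
      filter_upwards [eventually_ge_atTop m, eventually_ne_atTop 0] with N hN hN0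
      have : (N : ℂ) ≠ 0 := Nat.cast_ne_zero.2 hN0
      rw [Nat.cast_sub hN]
      field_simp
    have := h.mul ih
    rw [one_mul] at this
    refine this.congr fun N => ?_
    rw [Nat.descFactorial_succ, Nat.cast_mul, pow_succ']
    exact div_mul_div_comm _ _ _ _

/-- The limit of the normalized expected injective traces of the joint family. -/
def jointLimit (τm : ∀ j : Fin p, TestGraph (K j) → ℂ) (S : TestGraph (Σ j, K j)) : ℂ :=
  if S.IsFreeProduct then
    ∏ j, ∏ d : Quot (S.restrict j).Linked, injective (τm j) ((S.restrict j).connComp d)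
  else 0

theorem injTrace_restrict_sigma {N : ℕ} (A : ∀ j, K j → Matrix (Fin N) (Fin N) ℂ)
    {I : Type} [Fintype I] (S : I → TestGraph (Σ j, K j)) (j : Fin p) :
    (StarGraph.sigma fun x : (Σ i, Quot ((S i).restrict j).Linked) =>
      (((S x.1).restrict j).connComp x.2).toStarGraph).injTrace (A j) =
    ((StarGraph.sigma fun i => (S i).toStarGraph).restrict j).injTrace (A j) := by
  refine StarGraph.injTrace_congr
    { toFun := fun x => ⟨x.1.1, x.2.1⟩
      invFun := fun x => ⟨⟨x.1, Quot.mk _ x.2⟩, x.2, rfl⟩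
      left_inv := ?_
      right_inv := fun _ => rfl }
    { toFun := fun x => ⟨⟨x.1.1, x.2.1.1⟩, x.2.1.2⟩
      invFun := fun x => ⟨⟨x.1.1, Quot.mk _ ((S x.1.1).src x.1.2)⟩, ⟨x.1.2, x.2⟩, rfl⟩
      left_inv := ?_
      right_inv := fun _ => rfl }
    (fun _ => rfl) (fun _ => rfl) (fun _ => rfl)
  · rintro ⟨⟨i, d⟩, v⟩
    obtain ⟨v, hv⟩ : {v : (S i).V // Quot.mk ((S i).restrict j).Linked v = d} := v
    subst hv
    rfl
  · rintro ⟨⟨i, d⟩, e⟩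
    obtain ⟨e, he⟩ : {e : ((S i).restrict j).E //
      Quot.mk ((S i).restrict j).Linked ((S i).src e.1) = d} := e
    subst he
    rfl

theorem sigmaFactorizes_joint [∀ N, IsProbabilityMeasure (μ N)]
    (hmom : ∀ j, HasAllMoments μ (fun N => A N j))
    (hindep : ∀ N, iIndepFun
      (fun j ω k a b => A N j k ω a b : ∀ j : Fin p, Ω N → K j → Fin N → Fin N → ℂ) (μ N))
    (hperm : {j : Fin p | ¬ PermInvariant μ (fun N => A N j)}.Subsingleton)
    {τm : ∀ j : Fin p, TestGraph (K j) → ℂ} (hdec : ∀ j, Decorrelated μ (fun N => A N j) (τm j)) :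
    SigmaFactorizes μ (fun N (x : Σ j, K j) => A N x.1 x.2) (jointLimit τm) := by
  intro I _ S
  set T := StarGraph.sigma fun i => (S i).toStarGraph
  let C : Fin p → ℕ := fun j => ∑ i, Fintype.card (Quot ((S i).restrict j).Linked)
  let y : Fin p → ℕ → ℂ := fun j N => (1 / (N : ℂ)) ^ C j *
    ∫ ω, (T.restrict j).injTrace (fun k => A N j k ω) ∂(μ N)
  let m := Fintype.card T.V
  -- The normalized expectation is of order N^{-d}: exponent -|I| from the normalization, m - p·m
  -- from the counts of injective maps, and ∑ C_j from the restrictions. By `hdle` the natural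
  -- subtraction does not truncate.
  let d := Fintype.card I + p * m - (m + ∑ j, C j)
  have hm : m = ∑ i, Fintype.card (S i).V := Fintype.card_sigma
  have hC : ∑ j, C j = ∑ i, ∑ j, Fintype.card (Quot ((S i).restrict j).Linked) := Finset.sum_comm
  have hle : ∀ i ∈ (univ : Finset I),
      Fintype.card (S i).V + ∑ j, Fintype.card (Quot ((S i).restrict j).Linked) ≤
        1 + p * Fintype.card (S i).V := fun i _ => (S i).card_add_sum_card_connComp_le
  have hsum₁ : m + ∑ j, C j =
      ∑ i, (Fintype.card (S i).V + ∑ j, Fintype.card (Quot ((S i).restrict j).Linked)) := by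
    rw [hm, hC, Finset.sum_add_distrib]
  have hsum₂ : Fintype.card I + p * m = ∑ i, (1 + p * Fintype.card (S i).V) := by
    rw [hm, Finset.sum_add_distrib, Finset.mul_sum]
    simp
  have hdle : m + ∑ j, C j ≤ Fintype.card I + p * m := by
    rw [hsum₁, hsum₂]
    exact Finset.sum_le_sum hle
  have hy : ∀ j, Tendsto (y j) atTop (𝓝 (∏ i, ∏ d : Quot ((S i).restrict j).Linked,
      injective (τm j) (((S i).restrict j).connComp d))) := by
    intro j
    have h := (hdec j).sigmaFactorizes (hmom j) (Σ i, Quot ((S i).restrict j).Linked)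
      fun x => ((S x.1).restrict j).connComp x.2
    rw [Fintype.prod_sigma, Fintype.card_sigma] at h
    refine h.congr fun N => ?_
    simp only [y, C]
    congr 1
    exact integral_congr_ae (.of_forall fun ω =>
      injTrace_restrict_sigma (fun j k => A N j k ω) S j)
  have hr := tendsto_descFactorial_div_pow m
  have hlim : Tendsto (fun N : ℕ => (1 / (N : ℂ)) ^ d) atTop (𝓝 (if d = 0 then 1 else 0)) := by
    split_ifs with h
    · simp [h]
    · exact tendsto_one_div_natCast_pow h
  have hmain := (hlim.mul hr).mul
    (tendsto_finsetProd univ fun j _ => (hy j).div hr one_ne_zero)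
  have hval : ∏ i, jointLimit τm (S i) = (if d = 0 then 1 else 0) * 1 *
      ∏ j, (∏ i, ∏ d : Quot ((S i).restrict j).Linked,
        injective (τm j) (((S i).restrict j).connComp d)) / 1 := by
    -- The bounds hold term by term, so equality of their sums forces equality in each.
    have hd : d = 0 ↔ ∀ i, (S i).IsFreeProduct := by
      simp_rw [TestGraph.isFreeProduct_iff]
      have h := Finset.sum_eq_sum_iff_of_le hle
      simp only [mem_univ, true_imp_iff] at h
      rw [← h, ← hsum₁, ← hsum₂, Nat.sub_eq_zero_iff_le]
      exact ⟨fun h => le_antisymm hdle h, fun h => h.ge⟩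
    simp_rw [div_one]
    rw [Finset.prod_comm]
    unfold jointLimit
    split_ifs with h
    · rw [one_mul, one_mul]
      exact Finset.prod_congr rfl fun i _ => if_pos (hd.1 h i)
    · obtain ⟨i, hi⟩ := not_forall.1 fun h' => h (hd.2 h')
      rw [Finset.prod_eq_zero (mem_univ i) (if_neg hi), mul_one, zero_mul]
  rw [hval]
  refine hmain.congr' ?_
  -- For N ≥ m injective maps exist, so the division by their number is legitimate.
  filter_upwards [eventually_ge_atTop m, eventually_ne_atTop 0] with N hN hN0
  have hN0 : (N : ℂ) ≠ 0 := Nat.cast_ne_zero.2 hN0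
  have hM0 : (N.descFactorial m : ℂ) ≠ 0 :=
    Nat.cast_ne_zero.2 fun h => (Nat.descFactorial_eq_zero_iff_lt.1 h).not_ge hN
  rw [integral_injTrace_eq hmom hindep hperm]
  have hj : ∀ j, y j N / ((N.descFactorial m : ℂ) / (N : ℂ) ^ m) =
      ((N : ℂ) ^ m / (N : ℂ) ^ C j) *
        ((∫ ω, (T.restrict j).injTrace (fun k => A N j k ω) ∂(μ N)) /
          (N.descFactorial m : ℂ)) := by
    intro j
    simp only [y, one_div, inv_pow]
    field_simp
  simp_rw [Pi.div_apply, hj]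
  rw [Finset.prod_mul_distrib, ← mul_assoc, ← mul_assoc]
  congr 1
  rw [Finset.prod_div_distrib, Finset.prod_const, Finset.prod_pow_eq_pow_sum, Finset.card_univ,
    Fintype.card_fin, ← pow_mul]
  have hpow : (N : ℂ) ^ (d + (m + ∑ j, C j)) = (N : ℂ) ^ (Fintype.card I + p * m) := by
    rw [Nat.sub_add_cancel hdle]
  rw [pow_add, pow_add, pow_add] at hpow
  rw [one_div, inv_pow, inv_pow, mul_comm m p]
  field_simp
  linear_combination -(N.descFactorial m : ℂ) * hpow

/-! ### Traffic-freeness -/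

theorem injective_of_isEmpty {X : Type u} {A : ∀ N, X → Ω N → Matrix (Fin N) (Fin N) ℂ}
    [∀ N, IsProbabilityMeasure (μ N)] {τ : TestGraph X → ℂ} (h : ConvergesInTraffics μ A τ)
    (T : TestGraph X) [IsEmpty T.E] : injective τ T = 1 := by
  have hV := T.subsingleton_of_isEmpty
  have hτ : τ T = 1 := by
    refine tendsto_nhds_unique (h T) (tendsto_const_nhds.congr' ?_)
    filter_upwards [eventually_ne_atTop 0] with N hN
    simp [StarGraph.normTrace, StarGraph.trace_eq_sum_weight, StarGraph.weight, T.card_eq_one_of_isEmpty, hN]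
  have hs : IsEmpty {π : Setoid T.V // π ≠ ⊥} :=
    ⟨fun π => π.2 (Setoid.ext fun a b => by
      rw [Subsingleton.elim a b]
      exact ⟨fun _ => (⊥ : Setoid T.V).refl _, fun _ => π.1.refl _⟩)⟩
  rw [injective, hτ]
  simp

/-- Two changes separate `jointLimit` from the product over components: isolated vertices of the
restrictions contribute 1, and a component has the same injective trace viewed in its own family or
in the joint one. -/
theorem isTrafficFree_of_jointLimit [∀ N, IsProbabilityMeasure (μ N)]
    (hmom : ∀ j, HasAllMoments μ (fun N => A N j))
    {τm : ∀ j : Fin p, TestGraph (K j) → ℂ} (hdec : ∀ j, Decorrelated μ (fun N => A N j) (τm j))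
    {τ : TestGraph (Σ j, K j) → ℂ} (hτ : ∀ T, injective τ T = jointLimit τm T)
    (h : Decorrelated μ (fun N (x : Σ j, K j) => A N x.1 x.2) τ) : IsTrafficFree τ := by
  intro T
  rw [hτ T, jointLimit]
  refine if_congr Iff.rfl ?_ rfl
  rw [← Fintype.prod_sigma' fun j d => injective (τm j) ((T.restrict j).connComp d)]
  symm
  refine Fintype.prod_of_injective T.compClass T.compClass_injective _ _ ?_ ?_
  · rintro ⟨j, d⟩ hq
    have := T.isEmpty_connComp_edges hq
    exact injective_of_isEmpty (hdec j).convergesInTraffics _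
  · intro c
    refine tendsto_nhds_unique (h.tendsto_injTrace (hasAllMoments_sigma hmom) (T.comp c)) ?_
    refine ((hdec _).tendsto_injTrace (hmom _) _).congr fun N => ?_
    refine integral_congr_ae (.of_forall fun ω => ?_)
    exact congrArg _ (T.injTrace_comp (fun j k => A N j k ω) (c := c) rfl).symm

end

end Traffic

end

theorem mainTheorem1 {p : ℕ} {K : Fin p → Type*} {Ω : ℕ → Type*}
    [∀ N, MeasurableSpace (Ω N)] (μ : ∀ N, Measure (Ω N)) [∀ N, IsProbabilityMeasure (μ N)]
    (A : ∀ N, ∀ j : Fin p, K j → Ω N → Matrix (Fin N) (Fin N) ℂ)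
    (hmom : ∀ j, Traffic.HasAllMoments μ (fun N => A N j))
    (hindep : ∀ N, iIndepFun
      (fun j ω k a b => A N j k ω a b : ∀ j : Fin p, Ω N → K j → Fin N → Fin N → ℂ) (μ N))
    (hperm : {j : Fin p | ¬ Traffic.PermInvariant μ (fun N => A N j)}.Subsingleton)
    (τm : ∀ j : Fin p, Traffic.TestGraph (K j) → ℂ)
    (hconv : ∀ j, Traffic.ConvergesInTraffics μ (fun N => A N j) (τm j))
    (hdec : ∀ j, Traffic.Decorrelated μ (fun N => A N j) (τm j)) :
    ∃ τ : Traffic.TestGraph (Σ j, K j) → ℂ,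
      Traffic.ConvergesInTraffics μ (fun N (x : Σ j, K j) => A N x.1 x.2) τ ∧
      (∀ j (T : Traffic.TestGraph (K j)), τ (T.relabel (Sigma.mk j)) = τm j T) ∧
      Traffic.IsTrafficFree τ ∧
      Traffic.Decorrelated μ (fun N (x : Σ j, K j) => A N x.1 x.2) τ := by
  obtain ⟨τ, hτ, h⟩ := (Traffic.sigmaFactorizes_joint hmom hindep hperm hdec).exists_decorrelated
    (Traffic.hasAllMoments_sigma hmom)
  refine ⟨τ, h.convergesInTraffics, fun j T => ?_,
    Traffic.isTrafficFree_of_jointLimit hmom hdec hτ h, h⟩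
  -- Relabelling does not change the trace, so both values are limits of one sequence.
  exact tendsto_nhds_unique (h.convergesInTraffics (T.relabel (Sigma.mk j))) (hconv j T)
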